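/- A Bayesian routing instance consists of a finite directed or undirected graph $G=(V,E)$, speed scaling factors $\xi_e>0$ $(e\in E)$, agents $1,\dots,N$, and for each agent $i$ a finite type set $T_i$ with a probability distribution $p_i$; each type $t_i\in T_i$ specifies a pair $(u_i^{t_i},v_i^{t_i})\in V\times V$, and the set $A_i^{t_i}$ of (edge sets of) $(u_i^{t_i},v_i^{t_i})$-paths in $G$ is assumed to be nonempty. For a type profile $t\in T=T_1\times\dots\times T_N$ and an action profile $a\in A^t=A_1^{t_1}\times\dots\times A_N^{t_N}$ let $l_e^a=|\{i: e\in a_i\}|$. A strategy profile $s$ assigns to every agent $i$ and every type $t_i\in T_i$ an action $s_i(t_i)\in A_i^{t_i}$. For a load exponent $\alpha>1$ put $$C(s)=\mathbb E_{t\sim p}\Big[\sum_{e\in E}\xi_e\,(l_e^{s(t)})^{\alpha}\Big],\qquad \mathtt{OPT}(t)=\min_{a\in A^t}\sum_{e\in E}\xi_e\,(l_e^{a})^{\alpha},$$ where $p=\prod_i p_i$ is the product distribution. For fixed $\alpha$, the Bayesian competitive ratio (BCR) of an algorithm that constructs a strategy profile $s$ for every instance is the smallest $\beta\ge 1$ such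 that $C(s)\le\beta\cdot\mathbb E_{t\sim p}[\mathtt{OPT}(t)]$ on every instance. An algorithm is fully combinatorial if it is a program of a random access machine whose only operations on real numbers are additions, subtractions and comparisons. It runs in strongly polynomial time if, for each fixed $\alpha$, its number of elementary steps is bounded by a polynomial in $|V|+|E|+N+\sum_i|T_i|$, independently of the values of $\xi_e$ and $p_i(t_i)$. **Theorem 1.** There is a fully combinatorial, strongly polynomial-time algorithm which, given $\alpha>1$ and a Bayesian routing instance, constructs a strategy profile, and whose BCR is a finite number $\beta(\alpha)$ that depends only on $\alpha$. -/

import Mathlib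

/-! ## Bayesian routing -/

/-- A finite directed or undirected graph on the node set `Fin numNodes` with edge set
`Fin numEdges`. Edges are individually named by their end points, so parallel edges and loops are
permitted. -/
structure Network where
  numNodes : ℕ
  numEdges : ℕ
  directed : Bool
  src : Fin numEdges → Fin numNodes
  tgt : Fin numEdges → Fin numNodes

namespace Network

/-- The edge `e` can be used to go from `x` to `y`. -/
def Traverses (G : Network) (e : Fin G.numEdges) (x y : Fin G.numNodes) : Prop :=
  (G.src e = x ∧ G.tgt e = y) ∨ (G.directed = false ∧ G.src e = y ∧ G.tgt e = x)

/-- `G.IsWalk u l v`: the list `l` of pairs (edge, node reached by it) is a walk from `u` to `v`. -/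
def IsWalk (G : Network) :
    Fin G.numNodes → List (Fin G.numEdges × Fin G.numNodes) → Fin G.numNodes → Prop
  | u, [], v => u = v
  | u, (e, w) :: l, v => G.Traverses e u w ∧ G.IsWalk w l v

/-- `a` is the edge set of a `(u, v)`-path, i.e. of a walk from `u` to `v` without repeated nodes.
For `u = v` this means that `a` is empty. -/
def IsPathSet (G : Network) (u v : Fin G.numNodes) (a : Finset (Fin G.numEdges)) : Prop :=
  ∃ l : List (Fin G.numEdges × Fin G.numNodes),
    G.IsWalk u l v ∧ (u :: l.map Prod.snd).Nodup ∧ a = (l.map Prod.fst).toFinset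

end Network

/-- An instance of Bayesian routing, apart from the load exponent. Agent `i` has the finite type set
`Fin (numTypes i)`; type `t` of agent `i` requests a path from `source i t` to `sink i t` and
has prior probability `prior i t`. -/
structure BayesianRouting extends Network where
  numAgents : ℕ
  numTypes : Fin numAgents → ℕ
  source : (i : Fin numAgents) → Fin (numTypes i) → Fin numNodes
  sink : (i : Fin numAgents) → Fin (numTypes i) → Fin numNodes
  /-- the speed scaling factors -/
  speed : Fin numEdges → ℝ
  prior : (i : Fin numAgents) → Fin (numTypes i) → ℝ
  speed_pos : ∀ e, 0 < speed e
  prior_nonneg : ∀ i t, 0 ≤ prior i t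
  prior_sum : ∀ i, ∑ t, prior i t = 1
  /-- every request can be satisfied -/
  feasible : ∀ i t, ∃ a, toNetwork.IsPathSet (source i t) (sink i t) a

noncomputable section

namespace BayesianRouting

variable (I : BayesianRouting)

/-- The feasible actions of type `t` of agent `i`. -/
def Action (i : Fin I.numAgents) (t : Fin (I.numTypes i)) : Type :=
  {a : Finset (Fin I.numEdges) // I.toNetwork.IsPathSet (I.source i t) (I.sink i t) a}

/-- A type profile: one type for each agent. -/
abbrev TypeProfile : Type := (i : Fin I.numAgents) → Fin (I.numTypes i)

/-- The feasible action profiles for a type profile. -/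
abbrev ActionProfile (t : I.TypeProfile) : Type := (i : Fin I.numAgents) → I.Action i (t i)

/-- A strategy profile: the strategy of agent `i` maps each type of agent `i` to a feasible action
of that type. -/
abbrev StrategyProfile : Type :=
  (i : Fin I.numAgents) → (t : Fin (I.numTypes i)) → I.Action i t

/-- The number of agents whose actions include the edge `e`. -/
def load {t : I.TypeProfile} (a : I.ActionProfile t) (e : Fin I.numEdges) : ℕ :=
  (Finset.univ.filter fun i => e ∈ (a i).1).card

/-- Total cost of an action profile, for the edge cost functions `l ↦ speed e * l ^ α`. -/
def actionCost (α : ℝ) {t : I.TypeProfile} (a : I.ActionProfile t) : ℝ :=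
  ∑ e, I.speed e * (I.load a e : ℝ) ^ α

/-- Expectation of `f` when the types are drawn independently from the priors. -/
def expect (f : I.TypeProfile → ℝ) : ℝ :=
  ∑ t : I.TypeProfile, (∏ i, I.prior i (t i)) * f t

/-- Expected total cost of a strategy profile. -/
def cost (α : ℝ) (s : I.StrategyProfile) : ℝ :=
  I.expect fun t => I.actionCost α (t := t) fun i => s i (t i)

/-- Minimum total cost of an action profile feasible for `t` (an infimum over a finite nonempty
set). -/
def opt (α : ℝ) (t : I.TypeProfile) : ℝ :=
  ⨅ a : I.ActionProfile t, I.actionCost α a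

/-- The number of combinatorial items in the description of the instance. -/
def size : ℕ :=
  I.numNodes + I.numEdges + I.numAgents + ∑ i, I.numTypes i

end BayesianRouting

/-- `β` is the Bayesian competitive ratio, on the instances with load exponent `α`, of an algorithm
that constructs the strategy profile `A I` on instance `I`. -/
def IsBCR (α : ℝ) (A : (I : BayesianRouting) → I.StrategyProfile) (β : ℝ) : Prop :=
  IsLeast {b : ℝ | 1 ≤ b ∧
    ∀ I : BayesianRouting, I.cost α (A I) ≤ b * I.expect (I.opt α)} β

/-! ## Fully combinatorial algorithms

A random access machine with an integer memory, for control and addressing, and a real memory,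
for the numerical data. Both memories are organised in arrays: a cell is addressed by the number
of the array, fixed in the program, and three integer indices, which may be computed. The only
operations on real numbers are addition, subtraction and comparison, and the only constants are
natural numbers. -/

namespace Combinatorial

/-- Memory contents. -/
structure State where
  int : ℕ → ℕ → ℕ → ℕ → ℕ
  real : ℕ → ℕ → ℕ → ℕ → ℝ

/-- Store `v` in a cell of the integer memory. -/
def State.setInt (s : State) (a i j k v : ℕ) : State :=
  { s with int := fun a' i' j' k' =>
      if a' = a ∧ i' = i ∧ j' = j ∧ k' = k then v else s.int a' i' j' k' }

/-- Store `v` in a cell of the real memory. -/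
def State.setReal (s : State) (a i j k : ℕ) (v : ℝ) : State :=
  { s with real := fun a' i' j' k' =>
      if a' = a ∧ i' = i ∧ j' = j ∧ k' = k then v else s.real a' i' j' k' }

/-- Integer expressions. There is no multiplication, so that the length of an integer grows by at
most a constant per step. -/
inductive IntExpr where
  | lit (c : ℕ)
  | read (a : ℕ) (i j k : IntExpr)
  | add (x y : IntExpr)
  | sub (x y : IntExpr)

/-- Value of an integer expression (subtraction is truncated at `0`). -/
def IntExpr.eval (s : State) : IntExpr → ℕ
  | .lit c => c
  | .read a i j k => s.int a (i.eval s) (j.eval s) (k.eval s)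
  | .add x y => x.eval s + y.eval s
  | .sub x y => x.eval s - y.eval s

/-- Real expressions. -/
inductive RealExpr where
  | lit (c : ℕ)
  | read (a : ℕ) (i j k : IntExpr)
  | add (x y : RealExpr)
  | sub (x y : RealExpr)

/-- Value of a real expression. -/
def RealExpr.eval (s : State) : RealExpr → ℝ
  | .lit c => (c : ℝ)
  | .read a i j k => s.real a (i.eval s) (j.eval s) (k.eval s)
  | .add x y => x.eval s + y.eval s
  | .sub x y => x.eval s - y.eval s

/-- Tests. -/
inductive Test where
  | intLt (x y : IntExpr)
  | realLt (x y : RealExpr)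
  | neg (b : Test)
  | conj (b c : Test)

/-- Truth of a test. -/
def Test.Holds (s : State) : Test → Prop
  | .intLt x y => x.eval s < y.eval s
  | .realLt x y => x.eval s < y.eval s
  | .neg b => ¬ b.Holds s
  | .conj b c => b.Holds s ∧ c.Holds s

/-- Programs. -/
inductive Program where
  | skip
  | setInt (a : ℕ) (i j k : IntExpr) (x : IntExpr)
  | setReal (a : ℕ) (i j k : IntExpr) (x : RealExpr)
  | seq (P Q : Program)
  | branch (b : Test) (P Q : Program)
  | loop (b : Test) (P : Program)

/-- `Exec P s s' n`: started in `s`, the program `P` halts in `s'` after `n` steps. Every assignment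
and every evaluation of a test is one step; as a program contains finitely many expressions,
this agrees with the number of elementary operations up to a constant factor. -/
inductive Exec : Program → State → State → ℕ → Prop
  | skip (s : State) : Exec .skip s s 1
  | setInt (s : State) (a : ℕ) (i j k x : IntExpr) :
      Exec (.setInt a i j k x) s
        (s.setInt a (i.eval s) (j.eval s) (k.eval s) (x.eval s)) 1
  | setReal (s : State) (a : ℕ) (i j k : IntExpr) (x : RealExpr) :
      Exec (.setReal a i j k x) s
        (s.setReal a (i.eval s) (j.eval s) (k.eval s) (x.eval s)) 1
  | seq {P Q : Program} {s s' s'' : State} {m n : ℕ} :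
      Exec P s s' m → Exec Q s' s'' n → Exec (.seq P Q) s s'' (m + n)
  | branch_true {b : Test} {P Q : Program} {s s' : State} {n : ℕ} :
      b.Holds s → Exec P s s' n → Exec (.branch b P Q) s s' (n + 1)
  | branch_false {b : Test} {P Q : Program} {s s' : State} {n : ℕ} :
      ¬ b.Holds s → Exec Q s s' n → Exec (.branch b P Q) s s' (n + 1)
  | loop_false {b : Test} {P : Program} {s : State} :
      ¬ b.Holds s → Exec (.loop b P) s s 1
  | loop_true {b : Test} {P : Program} {s s' s'' : State} {m n : ℕ} :
      b.Holds s → Exec P s s' m → Exec (.loop b P) s' s'' n →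
      Exec (.loop b P) s s'' (m + n + 1)

/-- The memory in which the instance `I` with load exponent `α` is presented to a program.

Integer memory: array `0` holds the numbers of agents, nodes and edges and a flag for directed
graphs; array `1` the end points of edge `e` at `(e, 0, 0)` and `(e, 1, 0)`; array `2` the number of
types of agent `i` at `(i, 0, 0)`; array `3` the request of type `t` of agent `i` at `(i, t, 0)` and
`(i, t, 1)`. Real memory: array `0` holds `α`; array `1` the speed scaling factor of `e` at
`(e, 0, 0)`; array `2` the probability of type `t` of agent `i` at `(i, t, 0)`. All other
cells are `0`. -/
def input (α : ℝ) (I : BayesianRouting) : State where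
  int := fun a x y z =>
    match a, y, z with
    | 0, 0, 0 =>
      if x = 0 then I.numAgents
      else if x = 1 then I.numNodes
      else if x = 2 then I.numEdges
      else if x = 3 then (if I.directed = true then 1 else 0)
      else 0
    | 1, 0, 0 => if h : x < I.numEdges then (I.src ⟨x, h⟩ : ℕ) else 0
    | 1, 1, 0 => if h : x < I.numEdges then (I.tgt ⟨x, h⟩ : ℕ) else 0
    | 2, 0, 0 => if h : x < I.numAgents then I.numTypes ⟨x, h⟩ else 0
    | 3, t, 0 =>
      if h : x < I.numAgents then
        if ht : t < I.numTypes ⟨x, h⟩ then (I.source ⟨x, h⟩ ⟨t, ht⟩ : ℕ) else 0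
      else 0
    | 3, t, 1 =>
      if h : x < I.numAgents then
        if ht : t < I.numTypes ⟨x, h⟩ then (I.sink ⟨x, h⟩ ⟨t, ht⟩ : ℕ) else 0
      else 0
    | _, _, _ => 0
  real := fun a x y z =>
    match a, y, z with
    | 0, 0, 0 => if x = 0 then α else 0
    | 1, 0, 0 => if h : x < I.numEdges then I.speed ⟨x, h⟩ else 0
    | 2, t, 0 =>
      if h : x < I.numAgents then
        if ht : t < I.numTypes ⟨x, h⟩ then I.prior ⟨x, h⟩ ⟨t, ht⟩ else 0
      else 0
    | _, _, _ => 0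

/-- The memory `s` presents the strategy profile `σ` as a lookup table: the integer array `4` holds
a nonzero entry at `(i, t, e)` exactly if `e` belongs to the path chosen by type `t` of
agent `i`. -/
def IsOutput (I : BayesianRouting) (s : State) (σ : I.StrategyProfile) : Prop :=
  ∀ (i : Fin I.numAgents) (t : Fin (I.numTypes i)) (e : Fin I.numEdges),
    e ∈ (σ i t).1 ↔ s.int 4 i t e ≠ 0

/-- The program `P` computes `A α I` from `α` and `I`, for all `α > 1`, in a number of steps that,
for each fixed `α`, is at most polynomial in the number of nodes, edges, agents and types; it
does not depend on the values of the speed scaling factors and probabilities. The degree of the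
polynomial does not depend on `α`. -/
def ComputesInStronglyPolyTime (P : Program)
    (A : ℝ → (I : BayesianRouting) → I.StrategyProfile) : Prop :=
  ∃ (d : ℕ) (C : ℝ → ℝ), ∀ α : ℝ, 1 < α → ∀ I : BayesianRouting,
    ∃ (s : State) (n : ℕ), Exec P (input α I) s n ∧ IsOutput I s (A α I) ∧
      (n : ℝ) ≤ C α * ((I.size : ℝ) + 1) ^ d

end Combinatorial

end

/-!
The algorithm is a greedy one. The agents are processed in order, and the expected load `L e` that
the agents processed so far put on each edge is maintained. The types of the current agent take
shortest paths for edge weights within constant factors (depending on `α`) of the marginal cost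
`ξ e * (1 + L e) ^ (α - 1)`. The probability of a type scales the marginal cost of all its paths
equally, so no product of real numbers is needed, and since loads are at most the number of agents,
the power can be rounded to a power of two that is reached by few doublings (`roundedWeight`).
Shortest paths come from the Bellman–Ford algorithm, with the edge set of a walk stored
for each node (`Network.shortestPath_spec`); the number of steps does not depend on the weights.

Let `Λ` be the final expected loads and `Ψ = ∑ e, ξ e * Λ e * (1 + Λ e) ^ (α - 1)`
(`BayesianRouting.loadPotential`). The competitive ratio rests on three estimates.

* The load on `e` is a sum of independent indicators with mean `Λ e`, so its expected power of
  order `α` is at most a constant times `Λ e * (1 + Λ e) ^ (α - 1)`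
  (`BayesianRouting.expect_greedyCount_rpow_le`). Hence the cost is at most a constant times `Ψ`.
* The weights of the chosen paths, taken at the time of choice, add up in expectation to at least a
  constant times `Ψ`, because the marginal costs sum to `(1 + Λ e) ^ α - 1`
  (`BayesianRouting.loadPotential_le`).
* Each chosen path is no heavier than the one in an optimal action profile for the realised types.
  Loads only grow, so the total weight of the latter is at most a constant times
  `∑ e, ξ e * l e * (1 + Λ e) ^ (α - 1)`, where `l` is the load of the optimal profile; and either
  `l e` is a small fraction of `Λ e`, or `1 + Λ e` is at most a constant times `l e`. So the
  weight is at most a small multiple of `Ψ` plus a constant times the optimal cost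
  (`BayesianRouting.sum_greedyWeight_le`).

As the greedy choice depends only on the expected loads, which are deterministic, the type-dependent
optimum can be compared profile by profile. Together the estimates bound `Ψ`, and then the cost, by
a constant times the expected optimal cost. The factors that work for all instances form a closed
set, so there is a least one.

The program is verified against recursively defined counterparts of its loops
(`Network.Table.relaxEdges`, `Network.bellmanFord`, `BayesianRouting.greedyLoad`), by rules that
bound the number of steps along with establishing postconditions (`Combinatorial.Runs`).
-/

/-! ### Walks and shortest paths -/

namespace Network

variable {G : Network}

/-- Total weight of the edges of a walk, counted with multiplicity. -/
def walkCost (w : Fin G.numEdges → ℝ) (l : List (Fin G.numEdges × Fin G.numNodes)) : ℝ :=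
  (l.map fun p => w p.1).sum

@[simp] lemma walkCost_nil (w : Fin G.numEdges → ℝ) : walkCost w [] = 0 := rfl

@[simp] lemma walkCost_cons (w : Fin G.numEdges → ℝ) (p : Fin G.numEdges × Fin G.numNodes)
    (l : List (Fin G.numEdges × Fin G.numNodes)) :
    walkCost w (p :: l) = w p.1 + walkCost w l := by
  simp [walkCost]

@[simp] lemma walkCost_append (w : Fin G.numEdges → ℝ)
    (l l' : List (Fin G.numEdges × Fin G.numNodes)) :
    walkCost w (l ++ l') = walkCost w l + walkCost w l' := by
  simp [walkCost]

lemma walkCost_nonneg {w : Fin G.numEdges → ℝ} (hw : ∀ e, 0 < w e)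
    (l : List (Fin G.numEdges × Fin G.numNodes)) : 0 ≤ walkCost w l := by
  induction l with
  | nil => simp
  | cons p l ih => rw [walkCost_cons]; linarith [hw p.1]

lemma isWalk_concat {u v : Fin G.numNodes} {l : List (Fin G.numEdges × Fin G.numNodes)}
    {p : Fin G.numEdges × Fin G.numNodes} :
    G.IsWalk u (l ++ [p]) v ↔ p.2 = v ∧ ∃ x, G.IsWalk u l x ∧ G.Traverses p.1 x p.2 := by
  induction l generalizing u with
  | nil =>
    obtain ⟨e, y⟩ := p
    simp only [List.nil_append, IsWalk]
    constructor
    · rintro ⟨h, rfl⟩; exact ⟨rfl, u, rfl, h⟩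
    · rintro ⟨rfl, x, rfl, h⟩; exact ⟨h, rfl⟩
  | cons q l ih =>
    obtain ⟨e, y⟩ := q
    simp only [List.cons_append, IsWalk, ih]
    constructor
    · rintro ⟨h, hp, x, hx, hx'⟩; exact ⟨hp, x, ⟨h, hx⟩, hx'⟩
    · rintro ⟨hp, x, ⟨h, hx⟩, hx'⟩; exact ⟨h, hp, x, hx, hx'⟩

lemma IsWalk.exists_suffix {u v x : Fin G.numNodes}
    {l : List (Fin G.numEdges × Fin G.numNodes)} (h : G.IsWalk u l v)
    (hx : x ∈ l.map Prod.snd) :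
    ∃ l₁ l₂, l = l₁ ++ l₂ ∧ l₁ ≠ [] ∧ G.IsWalk x l₂ v := by
  induction l generalizing u with
  | nil => simp at hx
  | cons q l ih =>
    obtain ⟨e, y⟩ := q
    simp only [List.map_cons, List.mem_cons] at hx
    rcases hx with rfl | hx
    · exact ⟨[(e, x)], l, rfl, by simp, h.2⟩
    · obtain ⟨l₁, l₂, rfl, -, h₂⟩ := ih h.2 hx
      exact ⟨(e, y) :: l₁, l₂, rfl, by simp, h₂⟩

/-- A walk that visits a node twice can be shortened by cutting out a closed part. -/
lemma IsWalk.exists_shorter {w : Fin G.numEdges → ℝ} (hw : ∀ e, 0 < w e)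
    {u v : Fin G.numNodes} {l : List (Fin G.numEdges × Fin G.numNodes)} (h : G.IsWalk u l v)
    (hl : ¬ (u :: l.map Prod.snd).Nodup) :
    ∃ l', G.IsWalk u l' v ∧ l'.length < l.length ∧ walkCost w l' < walkCost w l := by
  induction l generalizing u with
  | nil => simp at hl
  | cons q l ih =>
    by_cases hu : u ∈ (q :: l).map Prod.snd
    · obtain ⟨l₁, l₂, hl', h₁, h₂⟩ := h.exists_suffix hu
      refine ⟨l₂, h₂, ?_, ?_⟩
      · rw [hl', List.length_append]
        have := List.length_pos_iff.2 h₁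
        omega
      · obtain ⟨p, l₁, rfl⟩ := List.exists_cons_of_ne_nil h₁
        rw [hl', walkCost_append, walkCost_cons]
        linarith [walkCost_nonneg hw l₁, hw p.1]
    · obtain ⟨e, y⟩ := q
      rw [List.nodup_cons, not_and] at hl
      obtain ⟨l', h₁, h₂, h₃⟩ := ih h.2 (hl hu)
      exact ⟨(e, y) :: l', ⟨h.1, h₁⟩, by simpa using h₂, by simpa using h₃⟩

lemma IsWalk.exists_simple {w : Fin G.numEdges → ℝ} (hw : ∀ e, 0 < w e)
    {u v : Fin G.numNodes} {l : List (Fin G.numEdges × Fin G.numNodes)} (h : G.IsWalk u l v) :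
    ∃ l', G.IsWalk u l' v ∧ (u :: l'.map Prod.snd).Nodup ∧ walkCost w l' ≤ walkCost w l := by
  induction hn : l.length using Nat.strong_induction_on generalizing l with
  | _ n ih =>
    by_cases hl : (u :: l.map Prod.snd).Nodup
    · exact ⟨l, h, hl, le_rfl⟩
    · obtain ⟨l', h₁, h₂, h₃⟩ := h.exists_shorter hw hl
      obtain ⟨l'', h₄, h₅, h₆⟩ := ih _ (hn ▸ h₂) h₁ rfl
      exact ⟨l'', h₄, h₅, h₆.trans h₃.le⟩

lemma IsWalk.exists_traverses {u v : Fin G.numNodes}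
    {l : List (Fin G.numEdges × Fin G.numNodes)} (h : G.IsWalk u l v) {e : Fin G.numEdges}
    (he : e ∈ l.map Prod.fst) : ∃ x, ∃ y ∈ l.map Prod.snd, G.Traverses e x y := by
  induction l generalizing u with
  | nil => simp at he
  | cons q l ih =>
    obtain ⟨e', y⟩ := q
    simp only [List.map_cons, List.mem_cons] at he ⊢
    rcases he with rfl | he
    · exact ⟨u, y, Or.inl rfl, h.1⟩
    · obtain ⟨x, z, hz, ht⟩ := ih h.2 he
      exact ⟨x, z, Or.inr hz, ht⟩

lemma IsWalk.nodup_edges {u v : Fin G.numNodes}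
    {l : List (Fin G.numEdges × Fin G.numNodes)} (h : G.IsWalk u l v)
    (hl : (u :: l.map Prod.snd).Nodup) : (l.map Prod.fst).Nodup := by
  induction l generalizing u with
  | nil => simp
  | cons q l ih =>
    obtain ⟨e, y⟩ := q
    rw [List.nodup_cons] at hl
    obtain ⟨hu, hl⟩ := hl
    rw [List.map_cons, List.nodup_cons]
    refine ⟨fun he => ?_, ih h.2 hl⟩
    obtain ⟨x, z, hz, ht⟩ := h.2.exists_traverses he
    simp only [List.map_cons, List.nodup_cons, List.mem_cons, not_or] at hl hu
    have hzy : z = y ∨ z = u := by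
      rcases h.1 with ⟨h₁, h₂⟩ | ⟨-, h₁, h₂⟩ <;> rcases ht with ⟨h₃, h₄⟩ | ⟨-, h₃, h₄⟩ <;>
        simp [← h₁, ← h₂, ← h₃, ← h₄]
    rcases hzy with rfl | rfl
    · exact hl.1 hz
    · exact hu.2 hz

/-- The state of the shortest path computation: for each node, a walk to it from the start, if
one has been found. -/
abbrev Table (G : Network) : Type :=
  Fin G.numNodes → Option (List (Fin G.numEdges × Fin G.numNodes))

/-- The table knows a walk to `v` of weight at most `c`. -/
def Table.Below (T : G.Table) (w : Fin G.numEdges → ℝ) (v : Fin G.numNodes) (c : ℝ) : Prop :=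
  ∃ l, T v = some l ∧ walkCost w l ≤ c

/-- Extending the known walk to `x` by the edge `e` gives a lighter walk to `y` than the known
one. -/
def Table.Improves (T : G.Table) (w : Fin G.numEdges → ℝ) (x : Fin G.numNodes)
    (e : Fin G.numEdges) (y : Fin G.numNodes) : Prop :=
  T x ≠ none ∧ ∀ l l', T x = some l → T y = some l' → walkCost w l + w e < walkCost w l'

open Classical in
/-- Replace the known walk to `y` by the one through `x` and `e`, if that is lighter. -/
noncomputable def Table.relax (T : G.Table) (w : Fin G.numEdges → ℝ) (x : Fin G.numNodes)
    (e : Fin G.numEdges) (y : Fin G.numNodes) : G.Table :=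
  if T.Improves w x e y then Function.update T y ((T x).map (· ++ [(e, y)])) else T

/-- Relax the edge `e` in all directions in which it can be traversed. -/
noncomputable def Table.relaxEdge (T : G.Table) (w : Fin G.numEdges → ℝ) (e : Fin G.numEdges) :
    G.Table :=
  if G.directed = true then T.relax w (G.src e) e (G.tgt e)
  else (T.relax w (G.src e) e (G.tgt e)).relax w (G.tgt e) e (G.src e)

/-- Relax the edges with numbers below `k`, one after the other. -/
noncomputable def Table.relaxEdges (T : G.Table) (w : Fin G.numEdges → ℝ) : ℕ → G.Table
  | 0 => T
  | k + 1 => if h : k < G.numEdges then (T.relaxEdges w k).relaxEdge w ⟨k, h⟩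
      else T.relaxEdges w k

/-- The Bellman–Ford table for the start node `u` after `k` rounds. -/
noncomputable def bellmanFord (w : Fin G.numEdges → ℝ) (u : Fin G.numNodes) : ℕ → G.Table
  | 0 => fun v => if v = u then some [] else none
  | k + 1 => (bellmanFord w u k).relaxEdges w G.numEdges

/-- The edge set of the walk from `u` to `v` found by the Bellman–Ford algorithm. -/
noncomputable def shortestPath (w : Fin G.numEdges → ℝ) (u v : Fin G.numNodes) :
    Finset (Fin G.numEdges) :=
  ((bellmanFord w u G.numNodes v).getD []).map Prod.fst |>.toFinset

namespace Table

variable {T : G.Table} {w : Fin G.numEdges → ℝ}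

lemma Below.relax {v : Fin G.numNodes} {c : ℝ} (h : T.Below w v c) (x : Fin G.numNodes)
    (e : Fin G.numEdges) (y : Fin G.numNodes) : (T.relax w x e y).Below w v c := by
  unfold Table.relax
  split_ifs with hi
  · obtain ⟨l, hl, hc⟩ := h
    by_cases hv : v = y
    · subst hv
      obtain ⟨l', hl'⟩ := Option.ne_none_iff_exists'.1 hi.1
      refine ⟨l' ++ [(e, v)], by simp [hl'], ?_⟩
      have := hi.2 l' l hl' hl
      simp; linarith
    · exact ⟨l, by simp [hv, hl], hc⟩
  · exact h

lemma Below.relax_apply {x : Fin G.numNodes} {c : ℝ} (h : T.Below w x c)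
    (e : Fin G.numEdges) (y : Fin G.numNodes) : (T.relax w x e y).Below w y (c + w e) := by
  obtain ⟨l, hl, hc⟩ := h
  unfold Table.relax
  split_ifs with hi
  · exact ⟨l ++ [(e, y)], by simp [hl], by simpa using hc⟩
  · simp only [Improves, hl, ne_eq, reduceCtorEq, not_false_eq_true, true_and, not_forall,
      not_lt] at hi
    obtain ⟨l₁, l', hl₁, hl', hle⟩ := hi
    cases hl₁
    exact ⟨l', hl', by linarith⟩

lemma Below.relaxEdge {v : Fin G.numNodes} {c : ℝ} (h : T.Below w v c) (e : Fin G.numEdges) :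
    (T.relaxEdge w e).Below w v c := by
  unfold Table.relaxEdge
  split_ifs
  · exact h.relax _ _ _
  · exact (h.relax _ _ _).relax _ _ _

lemma Below.relaxEdge_apply {x y : Fin G.numNodes} {c : ℝ} (h : T.Below w x c)
    {e : Fin G.numEdges} (he : G.Traverses e x y) : (T.relaxEdge w e).Below w y (c + w e) := by
  unfold Table.relaxEdge
  rcases he with ⟨rfl, rfl⟩ | ⟨hd, rfl, rfl⟩
  · split_ifs
    · exact h.relax_apply _ _
    · exact (h.relax_apply _ _).relax _ _ _
  · rw [if_neg (by simp [hd])]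
    exact (h.relax _ _ _).relax_apply _ _

lemma Below.relaxEdges {v : Fin G.numNodes} {c : ℝ} (h : T.Below w v c) (k : ℕ) :
    (T.relaxEdges w k).Below w v c := by
  induction k with
  | zero => exact h
  | succ k ih =>
    unfold Table.relaxEdges
    split_ifs
    · exact ih.relaxEdge _
    · exact ih

lemma Below.relaxEdges_apply {x y : Fin G.numNodes} {c : ℝ} (h : T.Below w x c)
    {e : Fin G.numEdges} (he : G.Traverses e x y) {k : ℕ} (hk : e < k) :
    (T.relaxEdges w k).Below w y (c + w e) := by
  induction k with
  | zero => omega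
  | succ k ih =>
    unfold Table.relaxEdges
    rcases Nat.lt_succ_iff_lt_or_eq.1 hk with hk | rfl
    · split_ifs
      · exact (ih hk).relaxEdge _
      · exact ih hk
    · rw [dif_pos e.2]
      exact (h.relaxEdges _).relaxEdge_apply he

/-- Every entry of the table is a walk from `u`. -/
def Sound (T : G.Table) (u : Fin G.numNodes) : Prop :=
  ∀ v l, T v = some l → G.IsWalk u l v

variable {u : Fin G.numNodes}

lemma Sound.relax (h : T.Sound u) {x y : Fin G.numNodes} {e : Fin G.numEdges}
    (he : G.Traverses e x y) : (T.relax w x e y).Sound u := by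
  unfold Table.relax
  split_ifs with hi
  · intro v l hl
    by_cases hv : v = y
    · subst hv
      simp only [Function.update_self, Option.map_eq_some_iff] at hl
      obtain ⟨l', hl', rfl⟩ := hl
      exact isWalk_concat.2 ⟨rfl, x, h _ _ hl', he⟩
    · exact h v l (by simpa [hv] using hl)
  · exact h

lemma Sound.relaxEdge (h : T.Sound u) (e : Fin G.numEdges) : (T.relaxEdge w e).Sound u := by
  unfold Table.relaxEdge
  have h' := h.relax (w := w) (e := e) (Or.inl ⟨rfl, rfl⟩)
  split_ifs with hd
  · exact h'
  · exact h'.relax (Or.inr ⟨by simpa using hd, rfl, rfl⟩)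

lemma Sound.relaxEdges (h : T.Sound u) (k : ℕ) : (T.relaxEdges w k).Sound u := by
  induction k with
  | zero => exact h
  | succ k ih =>
    unfold Table.relaxEdges
    split_ifs
    · exact ih.relaxEdge _
    · exact ih

end Table

lemma bellmanFord_sound (w : Fin G.numEdges → ℝ) (u : Fin G.numNodes) (k : ℕ) :
    (bellmanFord w u k).Sound u := by
  induction k with
  | zero =>
    intro v l hl
    simp only [bellmanFord, Option.ite_none_right_eq_some, Option.some.injEq] at hl
    obtain ⟨rfl, rfl⟩ := hl
    rfl
  | succ k ih => exact ih.relaxEdges _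

/-- After `k` rounds, the table is at least as good as every walk with at most `k` edges. -/
lemma bellmanFord_below (w : Fin G.numEdges → ℝ) {u v : Fin G.numNodes} (k : ℕ)
    {l : List (Fin G.numEdges × Fin G.numNodes)} (h : G.IsWalk u l v) (hl : l.length ≤ k) :
    (bellmanFord w u k).Below w v (walkCost w l) := by
  induction k generalizing l v with
  | zero =>
    obtain rfl : l = [] := List.length_eq_zero_iff.1 (by omega)
    obtain rfl : u = v := h
    exact ⟨[], by simp [bellmanFord], le_rfl⟩
  | succ k ih =>
    rcases List.eq_nil_or_concat' l with rfl | ⟨l, p, rfl⟩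
    · exact (ih h (by simp)).relaxEdges _
    · obtain ⟨rfl, x, hx, he⟩ := isWalk_concat.1 h
      have := (ih hx (by simpa using hl)).relaxEdges_apply he p.1.2
      simpa [bellmanFord] using this

lemma bellmanFord_below_of_simple (w : Fin G.numEdges → ℝ) {u v : Fin G.numNodes}
    {l : List (Fin G.numEdges × Fin G.numNodes)} (h : G.IsWalk u l v)
    (hl : (u :: l.map Prod.snd).Nodup) :
    (bellmanFord w u G.numNodes).Below w v (walkCost w l) :=
  bellmanFord_below w _ h (by
    have := List.Nodup.length_le_card hl
    simp only [List.length_cons, List.length_map, Fintype.card_fin] at this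
    omega)

lemma IsPathSet.exists_bellmanFord {u v : Fin G.numNodes} {a : Finset (Fin G.numEdges)}
    (ha : G.IsPathSet u v a) (w : Fin G.numEdges → ℝ) :
    ∃ l, bellmanFord w u G.numNodes v = some l := by
  obtain ⟨l, h, hl, -⟩ := ha
  obtain ⟨m, hm, -⟩ := bellmanFord_below_of_simple w h hl
  exact ⟨m, hm⟩

/-- The walk found by the Bellman–Ford algorithm for positive weights is a path, and it is
lightest: after as many rounds as there are nodes it is compared with all paths, hence with all
walks, and a lightest walk does not repeat a node. -/
lemma shortestPath_spec {w : Fin G.numEdges → ℝ} (hw : ∀ e, 0 < w e) {u v : Fin G.numNodes}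
    {a : Finset (Fin G.numEdges)} (ha : G.IsPathSet u v a) :
    G.IsPathSet u v (shortestPath w u v) ∧ ∑ e ∈ shortestPath w u v, w e ≤ ∑ e ∈ a, w e := by
  obtain ⟨l, h, hl, rfl⟩ := ha
  obtain ⟨m, hm, hml⟩ := bellmanFord_below_of_simple w h hl
  have hmw := bellmanFord_sound w u _ v m hm
  have hmn : (u :: m.map Prod.snd).Nodup := by
    by_contra hn
    obtain ⟨m₁, h₁, -, h₃⟩ := hmw.exists_shorter hw hn
    obtain ⟨m₂, h₄, h₅, h₆⟩ := h₁.exists_simple hw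
    obtain ⟨m₃, hm₃, h₇⟩ := bellmanFord_below_of_simple w h₄ h₅
    obtain rfl : m = m₃ := by simpa [hm] using hm₃
    linarith
  have hs : shortestPath w u v = (m.map Prod.fst).toFinset := by simp [shortestPath, hm]
  refine ⟨⟨m, hmw, hmn, hs⟩, ?_⟩
  rw [hs, List.sum_toFinset _ (hmw.nodup_edges hmn), List.sum_toFinset _ (h.nodup_edges hl)]
  simpa [walkCost, List.map_map, Function.comp_def] using hml

end Network

/-! ### Rules for running programs with a step bound -/

namespace Combinatorial

/-- Started in `s`, the program `P` halts after at most `B` steps in a state satisfying `Q`. -/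
def Runs (P : Program) (s : State) (B : ℕ) (Q : State → Prop) : Prop :=
  ∃ s' n, Exec P s s' n ∧ n ≤ B ∧ Q s'

namespace Runs

variable {P P' : Program} {s : State} {B B' B₁ B₂ : ℕ} {Q Q' R : State → Prop} {b : Test}

lemma mono (h : Runs P s B Q) (hB : B ≤ B') (hQ : ∀ s', Q s' → Q' s') : Runs P s B' Q' := by
  obtain ⟨s', n, h₁, h₂, h₃⟩ := h
  exact ⟨s', n, h₁, h₂.trans hB, hQ _ h₃⟩

lemma skip (h : Q s) : Runs .skip s 1 Q := ⟨s, 1, .skip s, le_rfl, h⟩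

lemma setInt {a : ℕ} {i j k x : IntExpr}
    (h : Q (s.setInt a (i.eval s) (j.eval s) (k.eval s) (x.eval s))) :
    Runs (.setInt a i j k x) s 1 Q := ⟨_, 1, .setInt s a i j k x, le_rfl, h⟩

lemma setReal {a : ℕ} {i j k : IntExpr} {x : RealExpr}
    (h : Q (s.setReal a (i.eval s) (j.eval s) (k.eval s) (x.eval s))) :
    Runs (.setReal a i j k x) s 1 Q := ⟨_, 1, .setReal s a i j k x, le_rfl, h⟩

lemma seq (h : Runs P s B₁ R) (h' : ∀ s', R s' → Runs P' s' B₂ Q) (hB : B₁ + B₂ ≤ B) :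
    Runs (.seq P P') s B Q := by
  obtain ⟨s', n, h₁, h₂, h₃⟩ := h
  obtain ⟨s'', n', h₄, h₅, h₆⟩ := h' s' h₃
  exact ⟨s'', n + n', .seq h₁ h₄, by omega, h₆⟩

lemma setInt_seq {a : ℕ} {i j k x : IntExpr}
    (h : Runs P (s.setInt a (i.eval s) (j.eval s) (k.eval s) (x.eval s)) B Q) :
    Runs (.seq (.setInt a i j k x) P) s (B + 1) Q :=
  seq (R := fun s' => s' = s.setInt a (i.eval s) (j.eval s) (k.eval s) (x.eval s))
    (setInt rfl) (by rintro _ rfl; exact h) (by omega)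

lemma setReal_seq {a : ℕ} {i j k : IntExpr} {x : RealExpr}
    (h : Runs P (s.setReal a (i.eval s) (j.eval s) (k.eval s) (x.eval s)) B Q) :
    Runs (.seq (.setReal a i j k x) P) s (B + 1) Q :=
  seq (R := fun s' => s' = s.setReal a (i.eval s) (j.eval s) (k.eval s) (x.eval s))
    (setReal rfl) (by rintro _ rfl; exact h) (by omega)

lemma branch (h : b.Holds s → Runs P s B Q) (h' : ¬ b.Holds s → Runs P' s B Q) :
    Runs (.branch b P P') s (B + 1) Q := by
  by_cases hb : b.Holds s
  · obtain ⟨s', n, h₁, h₂, h₃⟩ := h hb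
    exact ⟨s', n + 1, .branch_true hb h₁, by omega, h₃⟩
  · obtain ⟨s', n, h₁, h₂, h₃⟩ := h' hb
    exact ⟨s', n + 1, .branch_false hb h₁, by omega, h₃⟩

/-- A loop with an invariant that counts the iterations, of which there are at most `n`. -/
lemma loop {Inv : ℕ → State → Prop} {n : ℕ} (h₀ : Inv 0 s)
    (hstep : ∀ k s, Inv k s → b.Holds s → k < n ∧ Runs P s B (Inv (k + 1)))
    (hend : ∀ k s, Inv k s → ¬ b.Holds s → Q s) : Runs (.loop b P) s (n * (B + 1) + 1) Q := by
  suffices H : ∀ m k s, Inv k s → n - k = m → Runs (.loop b P) s (m * (B + 1) + 1) Q from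
    H n 0 s h₀ (by omega)
  intro m
  induction m with
  | zero =>
    intro k s hs hk
    have hb : ¬ b.Holds s := fun hb => by have := (hstep k s hs hb).1; omega
    exact ⟨s, 1, .loop_false hb, by omega, hend k s hs hb⟩
  | succ m ih =>
    intro k s hs hk
    by_cases hb : b.Holds s
    · obtain ⟨hkn, s', n₁, h₁, h₂, h₃⟩ := hstep k s hs hb
      obtain ⟨s'', n₂, h₄, h₅, h₆⟩ := ih (k + 1) s' h₃ (by omega)
      refine ⟨s'', n₁ + n₂ + 1, .loop_true hb h₁ h₄, ?_, h₆⟩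
      rw [Nat.succ_mul]
      omega
    · exact ⟨s, 1, .loop_false hb, by omega, hend k s hs hb⟩

end Runs

/-- The integer variable with number `a`, kept in the first cell of the array `a`. -/
def IntExpr.var (a : ℕ) : IntExpr := .read a (.lit 0) (.lit 0) (.lit 0)

@[simp] lemma IntExpr.eval_lit (s : State) (c : ℕ) : (IntExpr.lit c).eval s = c := rfl

@[simp] lemma IntExpr.eval_var (s : State) (a : ℕ) : (IntExpr.var a).eval s = s.int a 0 0 0 := rfl

@[simp] lemma IntExpr.eval_read (s : State) (a : ℕ) (i j k : IntExpr) :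
    (IntExpr.read a i j k).eval s = s.int a (i.eval s) (j.eval s) (k.eval s) := rfl

@[simp] lemma IntExpr.eval_add (s : State) (x y : IntExpr) :
    (IntExpr.add x y).eval s = x.eval s + y.eval s := rfl

@[simp] lemma RealExpr.eval_lit (s : State) (c : ℕ) : (RealExpr.lit c).eval s = c := rfl

@[simp] lemma RealExpr.eval_read (s : State) (a : ℕ) (i j k : IntExpr) :
    (RealExpr.read a i j k).eval s = s.real a (i.eval s) (j.eval s) (k.eval s) := rfl

@[simp] lemma RealExpr.eval_add (s : State) (x y : RealExpr) :
    (RealExpr.add x y).eval s = x.eval s + y.eval s := rfl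

@[simp] lemma RealExpr.eval_sub (s : State) (x y : RealExpr) :
    (RealExpr.sub x y).eval s = x.eval s - y.eval s := rfl

@[simp] lemma Test.holds_intLt (s : State) (x y : IntExpr) :
    (Test.intLt x y).Holds s ↔ x.eval s < y.eval s := Iff.rfl

@[simp] lemma Test.holds_realLt (s : State) (x y : RealExpr) :
    (Test.realLt x y).Holds s ↔ x.eval s < y.eval s := Iff.rfl

@[simp] lemma Test.holds_neg (s : State) (b : Test) : b.neg.Holds s ↔ ¬ b.Holds s := Iff.rfl

@[simp] lemma Test.holds_conj (s : State) (b c : Test) :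
    (b.conj c).Holds s ↔ b.Holds s ∧ c.Holds s := Iff.rfl

namespace State

variable (s : State) {a a' : ℕ} (i j k i' j' k' : ℕ)

@[simp] lemma setInt_real (v : ℕ) : (s.setInt a i j k v).real = s.real := rfl

@[simp] lemma setReal_int (v : ℝ) : (s.setReal a i j k v).int = s.int := rfl

lemma setInt_int_of_ne (h : a' ≠ a) (v : ℕ) : (s.setInt a i j k v).int a' = s.int a' := by
  funext; simp [setInt, h]

lemma setReal_real_of_ne (h : a' ≠ a) (v : ℝ) : (s.setReal a i j k v).real a' = s.real a' := by
  funext; simp [setReal, h]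

@[simp] lemma setInt_int_same (v : ℕ) : (s.setInt a i j k v).int a i' j' k' =
    if i' = i ∧ j' = j ∧ k' = k then v else s.int a i' j' k' := by
  simp [setInt]

@[simp] lemma setReal_real_same (v : ℝ) : (s.setReal a i j k v).real a i' j' k' =
    if i' = i ∧ j' = j ∧ k' = k then v else s.real a i' j' k' := by
  simp [setReal]

end State

/-- The states `s` and `s'` differ only in the integer arrays from `A` and the real arrays from
`B`. -/
structure Frame (A B : List ℕ) (s s' : State) : Prop where
  int : ∀ a, a ∉ A → s'.int a = s.int a
  real : ∀ a, a ∉ B → s'.real a = s.real a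

namespace Frame

variable {A A' A₁ B B' B₁ : List ℕ} {s s' s'' : State}

lemma refl (A B : List ℕ) (s : State) : Frame A B s s := ⟨fun _ _ => rfl, fun _ _ => rfl⟩

lemma trans (h : Frame A B s s') (h' : Frame A' B' s' s'')
    (hA : A ⊆ A₁ := by simp) (hA' : A' ⊆ A₁ := by simp) (hB : B ⊆ B₁ := by simp)
    (hB' : B' ⊆ B₁ := by simp) : Frame A₁ B₁ s s'' :=
  ⟨fun a ha => (h'.int a fun h => ha (hA' h)).trans (h.int a fun h => ha (hA h)),
    fun a ha => (h'.real a fun h => ha (hB' h)).trans (h.real a fun h => ha (hB h))⟩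

lemma setInt (h : Frame A B s s') (a i j k v : ℕ) (ha : a ∈ A := by simp) :
    Frame A B s (s'.setInt a i j k v) :=
  ⟨fun a' ha' => by
    rw [State.setInt_int_of_ne _ _ _ _ (by rintro rfl; exact ha' ha)]; exact h.int a' ha', h.real⟩

lemma setReal (h : Frame A B s s') (a i j k : ℕ) (v : ℝ) (ha : a ∈ B := by simp) :
    Frame A B s (s'.setReal a i j k v) :=
  ⟨h.int, fun a' ha' => by
    rw [State.setReal_real_of_ne _ _ _ _ (by rintro rfl; exact ha' ha)]; exact h.real a' ha'⟩

end Frame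

/-- `for c := 0, …, bound - 1 do P`, with the variable `c` as counter. -/
def Program.forLoop (c : ℕ) (bound : IntExpr) (P : Program) : Program :=
  .seq (.setInt c (.lit 0) (.lit 0) (.lit 0) (.lit 0))
    (.loop (.intLt (.var c) bound)
      (.seq P (.setInt c (.lit 0) (.lit 0) (.lit 0) (.add (.var c) (.lit 1)))))

/-- The invariant of a counting loop must not depend on the counter. -/
lemma Runs.forLoop {c : ℕ} {bound : IntExpr} {P : Program} {s : State} {B m z : ℕ}
    {Q : State → Prop} (Inv : ℕ → State → Prop) (hm : m ≤ z) (hz : 1 ≤ z)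
    (hc : ∀ k s v, Inv k s → Inv k (s.setInt c 0 0 0 v)) (h₀ : Inv 0 s)
    (hbound : ∀ k s, Inv k s → bound.eval s = m)
    (hstep : ∀ k s, k < m → Inv k s → s.int c 0 0 0 = k →
      Runs P s B fun s' => Inv (k + 1) s' ∧ s'.int c 0 0 0 = k)
    (hend : ∀ s, Inv m s → Q s) : Runs (.forLoop c bound P) s (z * (B + 4)) Q := by
  have H : Runs (.forLoop c bound P) s (m * ((B + 1) + 1) + 1 + 1) Q := by
    refine setInt_seq (loop (Inv := fun k s => Inv k s ∧ s.int c 0 0 0 = k ∧ k ≤ m) ?_ ?_ ?_)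
    · exact ⟨hc _ _ _ h₀, by simp, by omega⟩
    · rintro k s ⟨h, hk, -⟩ hb
      simp only [Test.holds_intLt, IntExpr.eval_var, hk, hbound k s h] at hb
      refine ⟨hb, seq (hstep k s hb h hk) ?_ le_rfl⟩
      rintro s' ⟨h', hk'⟩
      exact setInt ⟨hc _ _ _ h', by simp [hk'], hb⟩
    · rintro k s ⟨h, hk, hkm⟩ hb
      simp only [Test.holds_intLt, IntExpr.eval_var, hk, hbound k s h] at hb
      obtain rfl : k = m := by omega
      exact hend s h
  refine H.mono ?_ fun _ => id
  nlinarith [Nat.mul_le_mul_right (B + 2) hm]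

end Combinatorial

/-! ### The shortest path program -/

namespace Combinatorial

open IntExpr in
/-- Replace the edge set stored for the node in variable 21 by the one stored for the node in
variable 20. -/
def copyPath : Program :=
  .forLoop 14 (read 0 (lit 2) (lit 0) (lit 0))
    (.setInt 6 (var 21) (var 14) (lit 0) (read 6 (var 20) (var 14) (lit 0)))

open IntExpr in
/-- Relax the edge in variable 13, traversed from the node in variable 20 to the one in
variable 21. For each node, the integer array 5 tells whether a walk to it is known, the real array
5 holds the weight of this walk, and the integer array 6 its edge set; the real array 4 holds the
edge weights. -/
def relaxProgram : Program :=
  .branch (.conj (.intLt (lit 0) (read 5 (var 20) (lit 0) (lit 0)))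
      (.neg (.conj (.intLt (lit 0) (read 5 (var 21) (lit 0) (lit 0)))
        (.neg (.realLt (.add (.read 5 (var 20) (lit 0) (lit 0)) (.read 4 (var 13) (lit 0) (lit 0)))
          (.read 5 (var 21) (lit 0) (lit 0)))))))
    (.seq (.setReal 5 (var 21) (lit 0) (lit 0)
        (.add (.read 5 (var 20) (lit 0) (lit 0)) (.read 4 (var 13) (lit 0) (lit 0))))
      (.seq (.setInt 5 (var 21) (lit 0) (lit 0) (lit 1))
        (.seq copyPath (.setInt 6 (var 21) (var 13) (lit 0) (lit 1)))))
    .skip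

open IntExpr in
/-- Relax the edge in variable 13, traversed from its end point number `c` to the one with
number `d`. -/
def relaxTowardsProgram (c d : ℕ) : Program :=
  .seq (.setInt 20 (lit 0) (lit 0) (lit 0) (read 1 (var 13) (lit c) (lit 0)))
    (.seq (.setInt 21 (lit 0) (lit 0) (lit 0) (read 1 (var 13) (lit d) (lit 0))) relaxProgram)

open IntExpr in
/-- Relax the edge in variable 13 in all directions in which it can be traversed. -/
def relaxEdgeProgram : Program :=
  .seq (relaxTowardsProgram 0 1)
    (.branch (.intLt (lit 0) (read 0 (lit 3) (lit 0) (lit 0))) .skip (relaxTowardsProgram 1 0))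

open IntExpr in
/-- The table in which only the node in variable 22 is reached. -/
def initProgram : Program :=
  .seq (.forLoop 14 (read 0 (lit 1) (lit 0) (lit 0))
      (.setInt 5 (var 14) (lit 0) (lit 0) (lit 0)))
    (.seq (.forLoop 14 (read 0 (lit 2) (lit 0) (lit 0))
        (.setInt 6 (var 22) (var 14) (lit 0) (lit 0)))
      (.seq (.setInt 5 (var 22) (lit 0) (lit 0) (lit 1))
        (.setReal 5 (var 22) (lit 0) (lit 0) (.lit 0))))

open IntExpr in
/-- The Bellman–Ford algorithm with the node in variable 22 as start. -/
def bellmanFordProgram : Program :=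
  .seq initProgram
    (.forLoop 12 (read 0 (lit 1) (lit 0) (lit 0))
      (.forLoop 13 (read 0 (lit 2) (lit 0) (lit 0)) relaxEdgeProgram))

/-- The memory `s` presents the network `G` with edge weights `w`. -/
structure Presents (s : State) (G : Network) (w : Fin G.numEdges → ℝ) : Prop where
  nodes : s.int 0 1 0 0 = G.numNodes
  edges : s.int 0 2 0 0 = G.numEdges
  directed : s.int 0 3 0 0 = if G.directed = true then 1 else 0
  src : ∀ e : Fin G.numEdges, s.int 1 e 0 0 = G.src e
  tgt : ∀ e : Fin G.numEdges, s.int 1 e 1 0 = G.tgt e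
  weight : ∀ e : Fin G.numEdges, s.real 4 e 0 0 = w e

/-- The memory `s` holds the table `T`. -/
def HoldsTable (s : State) {G : Network} (w : Fin G.numEdges → ℝ) (T : G.Table) : Prop :=
  ∀ v : Fin G.numNodes, (T v = none → s.int 5 v 0 0 = 0) ∧
    ∀ l, T v = some l → 0 < s.int 5 v 0 0 ∧ s.real 5 v 0 0 = Network.walkCost w l ∧
      ∀ e : Fin G.numEdges, 0 < s.int 6 v e 0 ↔ e ∈ l.map Prod.fst

variable {s s' : State} {G : Network} {w : Fin G.numEdges → ℝ} {T : G.Table} {A B : List ℕ} {z : ℕ}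

lemma Presents.frame (h : Presents s G w) (hf : Frame A B s s') (h₀ : 0 ∉ A := by simp)
    (h₁ : 1 ∉ A := by simp) (h₄ : 4 ∉ B := by simp) : Presents s' G w := by
  obtain ⟨a, b, c, d, e, f⟩ := h
  constructor <;> simpa only [hf.int 0 h₀, hf.int 1 h₁, hf.real 4 h₄]

lemma HoldsTable.frame (h : HoldsTable s w T) (hf : Frame A B s s') (h₀ : 5 ∉ A := by simp)
    (h₁ : 6 ∉ A := by simp) (h₄ : 5 ∉ B := by simp) : HoldsTable s' w T := by
  unfold HoldsTable at *
  simpa only [hf.int 5 h₀, hf.int 6 h₁, hf.real 5 h₄]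

/-- The two nodes may coincide; then nothing changes. -/
lemma runs_copyPath (hE : Presents s G w) (hz : 1 ≤ z) (hM : G.numEdges ≤ z) :
    Runs copyPath s (5 * z) fun s' => Frame [6, 14] [] s s' ∧
      ∀ v e, s'.int 6 v e 0 = if v = s.int 21 0 0 0 ∧ e < G.numEdges then
        s.int 6 (s.int 20 0 0 0) e 0 else s.int 6 v e 0 := by
  refine (Runs.forLoop (m := G.numEdges) (z := z) (B := 1) (fun k s' => Frame [6, 14] [] s s' ∧
      ∀ v e, s'.int 6 v e 0 = if v = s.int 21 0 0 0 ∧ e < k then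
        s.int 6 (s.int 20 0 0 0) e 0 else s.int 6 v e 0) hM hz ?_ ?_ ?_ ?_ fun _ => id).mono
    (by omega) fun _ => id
  · rintro k s' v ⟨h, h'⟩
    refine ⟨h.setInt _ _ _ _ _, ?_⟩
    rwa [State.setInt_int_of_ne _ _ _ _ (by simp)]
  · exact ⟨Frame.refl _ _ _, by simp⟩
  · rintro k s' ⟨h, h'⟩
    simpa using (hE.frame h).edges
  · rintro k s' hk ⟨h, h'⟩ hc
    refine Runs.setInt ⟨⟨h.setInt _ _ _ _ _, fun v e => ?_⟩, ?_⟩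
    · have h20 := h.int 20 (by simp)
      have h21 := h.int 21 (by simp)
      simp only [IntExpr.eval_var, IntExpr.eval_lit, IntExpr.eval_read, State.setInt_int_same, h20,
        h21, hc, h']
      by_cases hv : v = s.int 21 0 0 0 <;> by_cases he : e = k
      · simp [hv, he]
      · have : e < k + 1 ↔ e < k := by omega
        simp [hv, he, this]
      · simp [hv]
      · simp [hv]
    · rw [State.setInt_int_of_ne _ _ _ _ (by simp)]
      exact hc

lemma runs_relaxProgram (hE : Presents s G w) (hT : HoldsTable s w T) (hz : 1 ≤ z)
    (hM : G.numEdges ≤ z) {x y : Fin G.numNodes} {e : Fin G.numEdges} (hx : s.int 20 0 0 0 = x)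
    (hy : s.int 21 0 0 0 = y) (he : s.int 13 0 0 0 = e) :
    Runs relaxProgram s (9 * z) fun s' => Frame [5, 6, 14] [5] s s' ∧
      HoldsTable s' w (T.relax w x e y) := by
  have htest : (0 < s.int 5 x 0 0 ∧ ¬ (0 < s.int 5 y 0 0 ∧
      ¬ s.real 5 x 0 0 + s.real 4 e 0 0 < s.real 5 y 0 0)) ↔ T.Improves w x e y := by
    rw [hE.weight]
    unfold Network.Table.Improves
    rcases hTx : T x with - | l
    · simp [(hT x).1 hTx]
    · obtain ⟨h₁, h₂, -⟩ := (hT x).2 l hTx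
      rcases hTy : T y with - | l'
      · simp [(hT y).1 hTy, h₁]
      · obtain ⟨h₃, h₄, -⟩ := (hT y).2 l' hTy
        simp [h₁, h₂, h₃, h₄]
  refine (Runs.branch (B := 5 * z + 3) (fun hb => ?_) fun hb => ?_).mono (by omega) fun _ => id
  · simp only [Test.holds_conj, Test.holds_neg, Test.holds_intLt, Test.holds_realLt,
      IntExpr.eval_var, IntExpr.eval_lit, IntExpr.eval_read, RealExpr.eval_add,
      RealExpr.eval_read, hx, hy, he] at hb
    rw [htest] at hb
    obtain ⟨l, hl⟩ := Option.ne_none_iff_exists'.1 hb.1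
    obtain ⟨hl₁, hl₂, hl₃⟩ := (hT x).2 l hl
    refine Runs.setReal_seq (Runs.setInt_seq (Runs.seq (runs_copyPath (G := G) (w := w) ?_ hz hM)
      ?_ le_rfl))
    · exact hE.frame (((Frame.refl [5] [5] s).setReal _ _ _ _ _).setInt _ _ _ _ _)
    · simp only [IntExpr.eval_var, IntExpr.eval_lit, RealExpr.eval_add, RealExpr.eval_read,
        State.setReal_int, hx, hy, he]
      rintro s₁ ⟨hf, hs₁⟩
      have hf₁ : Frame [5, 6, 14] [5] s s₁ :=
        (((Frame.refl [5] [5] s).setReal _ _ _ _ _).setInt _ _ _ _ _).trans hf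
      refine Runs.setInt ⟨hf₁.setInt _ _ _ _ _, ?_⟩
      rw [Network.Table.relax, if_pos hb]
      simp only [IntExpr.eval_var, IntExpr.eval_lit, hf₁.int 21 (by simp), hf₁.int 13 (by simp),
        hy, he]
      have h5 : s₁.int 5 = (s.setInt 5 y 0 0 1).int 5 := by
        rw [hf.int 5 (by simp)]; rfl
      have h5' : s₁.real 5 = (s.setReal 5 y 0 0 (s.real 5 x 0 0 + s.real 4 e 0 0)).real 5 := by
        rw [hf.real 5 (by simp)]; rfl
      simp only [State.setInt_int_of_ne _ _ _ _ (show 20 ≠ 5 by simp),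
        State.setInt_int_of_ne _ _ _ _ (show 21 ≠ 5 by simp),
        State.setInt_int_of_ne _ _ _ _ (show 6 ≠ 5 by simp), State.setReal_int, hx, hy] at hs₁
      intro v
      by_cases hv : v = y
      · subst hv
        refine ⟨by simp [hl], fun l' hl' => ?_⟩
        obtain rfl : l ++ [(e, v)] = l' := by simpa [hl] using hl'
        refine ⟨?_, ?_, fun e' => ?_⟩
        · simp [State.setInt_int_of_ne, h5]
        · simp [h5', hl₂, hE.weight]
        · by_cases hee : e' = e
          · simp [hee]
          · have : (e' : ℕ) ≠ e := fun h => hee (Fin.ext h)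
            simp only [State.setInt_int_same, this, hs₁]
            simp [hl₃, hee]
      · have hv' : (v : ℕ) ≠ y := fun h => hv (Fin.ext h)
        simp only [State.setInt_int_of_ne _ _ _ _ (show 5 ≠ 6 by simp), State.setInt_real, h5, h5',
          State.setInt_int_same, State.setReal_real_same, hs₁, hv', false_and, if_false,
          Function.update_of_ne hv]
        exact hT v
  · simp only [Test.holds_conj, Test.holds_neg, Test.holds_intLt, Test.holds_realLt,
      IntExpr.eval_var, IntExpr.eval_lit, IntExpr.eval_read, RealExpr.eval_add,
      RealExpr.eval_read, hx, hy, he] at hb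
    rw [htest] at hb
    rw [Network.Table.relax, if_neg hb]
    exact (Runs.skip ⟨Frame.refl _ _ _, hT⟩).mono (by omega) fun _ => id

lemma runs_relaxTowardsProgram (hE : Presents s G w) (hT : HoldsTable s w T) (hz : 1 ≤ z)
    (hM : G.numEdges ≤ z) {c d : ℕ} {x y : Fin G.numNodes} {e : Fin G.numEdges}
    (he : s.int 13 0 0 0 = e) (hx : s.int 1 e c 0 = x) (hy : s.int 1 e d 0 = y) :
    Runs (relaxTowardsProgram c d) s (9 * z + 2) fun s' =>
      Frame [5, 6, 14, 20, 21] [5] s s' ∧ HoldsTable s' w (T.relax w x e y) := by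
  have hf := ((Frame.refl [20, 21] [] s).setInt 20 0 0 0 x).setInt 21 0 0 0 y
  refine Runs.setInt_seq (Runs.setInt_seq ?_)
  simp only [IntExpr.eval_var, IntExpr.eval_lit, IntExpr.eval_read, he, hx,
    State.setInt_int_of_ne _ _ _ _ (show 1 ≠ 20 by simp),
    State.setInt_int_of_ne _ _ _ _ (show 13 ≠ 20 by simp), hy]
  refine (runs_relaxProgram (hE.frame hf) (hT.frame hf) hz hM (x := x) (y := y) (e := e)
    ?_ ?_ ?_).mono le_rfl ?_
  · simp [State.setInt_int_of_ne]
  · simp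
  · rw [hf.int 13 (by simp), he]
  · rintro s' ⟨h, h'⟩
    exact ⟨hf.trans h, h'⟩

lemma runs_relaxEdgeProgram (hE : Presents s G w) (hT : HoldsTable s w T) (hz : 1 ≤ z)
    (hM : G.numEdges ≤ z) {e : Fin G.numEdges} (he : s.int 13 0 0 0 = e) :
    Runs relaxEdgeProgram s (23 * z) fun s' => Frame [5, 6, 14, 20, 21] [5] s s' ∧
      HoldsTable s' w (T.relaxEdge w e) := by
  refine Runs.seq (B₂ := 9 * z + 3) (runs_relaxTowardsProgram hE hT hz hM he (hE.src e) (hE.tgt e))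
    ?_ (by omega)
  rintro s₁ ⟨hf, hT₁⟩
  have hE₁ := hE.frame hf
  unfold Network.Table.relaxEdge
  refine Runs.branch (fun hb => ?_) fun hb => ?_
  · have hd : G.directed = true := by
      by_contra hd
      simp [hE₁.directed, hd] at hb
    rw [if_pos hd]
    exact (Runs.skip ⟨hf, hT₁⟩).mono (by omega) fun _ => id
  · have hd : ¬ G.directed = true := fun hd => hb (by simp [hE₁.directed, hd])
    rw [if_neg hd]
    refine (runs_relaxTowardsProgram hE₁ hT₁ hz hM (e := e) ?_ (hE₁.tgt e) (hE₁.src e)).mono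
      le_rfl ?_
    · rw [hf.int 13 (by simp), he]
    · rintro s' ⟨h, h'⟩
      exact ⟨hf.trans h, h'⟩

lemma runs_relaxEdges (hE : Presents s G w) (hT : HoldsTable s w T) (hz : 1 ≤ z)
    (hM : G.numEdges ≤ z) :
    Runs (.forLoop 13 (.read 0 (.lit 2) (.lit 0) (.lit 0)) relaxEdgeProgram) s (z * (27 * z))
      fun s' => Frame [5, 6, 13, 14, 20, 21] [5] s s' ∧
        HoldsTable s' w (T.relaxEdges w G.numEdges) := by
  refine (Runs.forLoop (m := G.numEdges) (z := z) (B := 23 * z)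
    (fun k s' => Frame [5, 6, 13, 14, 20, 21] [5] s s' ∧ HoldsTable s' w (T.relaxEdges w k))
    hM hz ?_ ?_ ?_ ?_ fun _ => id).mono (Nat.mul_le_mul_left _ (by omega)) fun _ => id
  · rintro k s' v ⟨h, h'⟩
    exact ⟨h.setInt _ _ _ _ _, h'.frame ((Frame.refl [13] [] s').setInt _ _ _ _ _)⟩
  · exact ⟨Frame.refl _ _ _, hT⟩
  · rintro k s' ⟨h, h'⟩
    simpa using (hE.frame h).edges
  · rintro k s' hk ⟨h, h'⟩ hc
    refine (runs_relaxEdgeProgram (hE.frame h) h' hz hM (e := ⟨k, hk⟩) hc).mono le_rfl ?_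
    rintro s'' ⟨h₁, h₁'⟩
    refine ⟨⟨h.trans h₁, ?_⟩, by rw [h₁.int 13 (by simp), hc]⟩
    rwa [Network.Table.relaxEdges, dif_pos hk]

lemma runs_initProgram (hE : Presents s G w) (hz : 1 ≤ z) (hn : G.numNodes ≤ z)
    (hM : G.numEdges ≤ z) {u : Fin G.numNodes} (hu : s.int 22 0 0 0 = u) :
    Runs initProgram s (12 * z) fun s' => Frame [5, 6, 14] [5] s s' ∧
      HoldsTable s' w (Network.bellmanFord w u 0) := by
  refine Runs.seq (B₁ := z * 5) (B₂ := z * 5 + 2)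
    (R := fun s' => Frame [5, 6, 14] [5] s s' ∧ ∀ v < G.numNodes, s'.int 5 v 0 0 = 0) ?_ ?_
    (by omega)
  · refine Runs.forLoop (B := 1) (fun k s' => Frame [5, 6, 14] [5] s s' ∧
      ∀ v < k, s'.int 5 v 0 0 = 0) hn hz ?_ ?_ ?_ ?_ fun _ => id
    · rintro k s' v ⟨h, h'⟩
      refine ⟨h.setInt _ _ _ _ _, ?_⟩
      rwa [State.setInt_int_of_ne _ _ _ _ (by simp)]
    · exact ⟨Frame.refl _ _ _, by simp⟩
    · rintro k s' ⟨h, h'⟩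
      simpa using (hE.frame h).nodes
    · rintro k s' hk ⟨h, h'⟩ hc
      refine Runs.setInt ⟨⟨h.setInt _ _ _ _ _, fun v hv => ?_⟩, ?_⟩
      · by_cases hvk : v = k
        · simp [hc, hvk]
        · simp [hc, hvk, h' v (by omega)]
      · rwa [State.setInt_int_of_ne _ _ _ _ (by simp)]
  rintro s₁ ⟨hf₁, hs₁⟩
  have hE₁ := hE.frame hf₁
  refine Runs.seq (B₁ := z * 5) (B₂ := 2)
    (R := fun s' => Frame [6, 14] [] s₁ s' ∧ ∀ e < G.numEdges, s'.int 6 u e 0 = 0) ?_ ?_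
    (by omega)
  · refine Runs.forLoop (B := 1) (fun k s' => Frame [6, 14] [] s₁ s' ∧
      ∀ e < k, s'.int 6 u e 0 = 0) hM hz ?_ ?_ ?_ ?_ fun _ => id
    · rintro k s' v ⟨h, h'⟩
      refine ⟨h.setInt _ _ _ _ _, ?_⟩
      rwa [State.setInt_int_of_ne _ _ _ _ (by simp)]
    · exact ⟨Frame.refl _ _ _, by simp⟩
    · rintro k s' ⟨h, h'⟩
      simpa using (hE₁.frame h).edges
    · rintro k s' hk ⟨h, h'⟩ hc
      have hu' : s'.int 22 0 0 0 = u := by rw [h.int 22 (by simp), hf₁.int 22 (by simp), hu]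
      refine Runs.setInt ⟨⟨h.setInt _ _ _ _ _, fun v hv => ?_⟩, ?_⟩
      · by_cases hvk : v = k
        · simp [hc, hvk, hu']
        · simp [hc, hvk, hu', h' v (by omega)]
      · rwa [State.setInt_int_of_ne _ _ _ _ (by simp)]
  rintro s₂ ⟨hf₂, hs₂⟩
  have hf : Frame [5, 6, 14] [5] s s₂ := hf₁.trans hf₂
  refine Runs.setInt_seq (Runs.setReal ⟨(hf.setInt _ _ _ _ _).setReal _ _ _ _ _, ?_⟩)
  have hu₂ : s₂.int 22 0 0 0 = u := by rw [hf.int 22 (by simp), hu]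
  have h5 := hf₂.int 5 (by simp)
  intro v
  simp only [IntExpr.eval_var, IntExpr.eval_lit, hu₂, State.setReal_int,
    State.setInt_int_of_ne _ _ _ _ (show 22 ≠ 5 by simp),
    State.setInt_int_of_ne _ _ _ _ (show 6 ≠ 5 by simp), Network.bellmanFord]
  by_cases hv : v = u
  · subst hv
    simp [hs₂]
  · have hv' : (v : ℕ) ≠ u := fun h => hv (Fin.ext h)
    simp [hv, hv', h5, hs₁]

lemma runs_bellmanFordProgram (hE : Presents s G w) (hz : 1 ≤ z) (hn : G.numNodes ≤ z)
    (hM : G.numEdges ≤ z) {u : Fin G.numNodes} (hu : s.int 22 0 0 0 = u) :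
    Runs bellmanFordProgram s (43 * z ^ 3) fun s' =>
      Frame [5, 6, 12, 13, 14, 20, 21] [5] s s' ∧
        HoldsTable s' w (Network.bellmanFord w u G.numNodes) := by
  refine Runs.seq (runs_initProgram hE hz hn hM hu) (B₂ := z * (z * (27 * z) + 4)) ?_ ?_
  · rintro s₁ ⟨hf₁, hT₁⟩
    have hE₁ := hE.frame hf₁
    refine Runs.forLoop (m := G.numNodes) (fun k s' => Frame [5, 6, 12, 13, 14, 20, 21] [5] s s' ∧
      HoldsTable s' w (Network.bellmanFord w u k)) hn hz ?_ ?_ ?_ ?_ fun _ => id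
    · rintro k s' v ⟨h, h'⟩
      exact ⟨h.setInt _ _ _ _ _, h'.frame ((Frame.refl [12] [] s').setInt _ _ _ _ _)⟩
    · exact ⟨hf₁.trans (Frame.refl [] [] _), hT₁⟩
    · rintro k s' ⟨h, h'⟩
      simpa using (hE.frame h).nodes
    · rintro k s' hk ⟨h, h'⟩ hc
      refine (runs_relaxEdges (hE.frame h) h' hz hM).mono le_rfl ?_
      rintro s'' ⟨h₁, h₁'⟩
      exact ⟨⟨h.trans h₁, h₁'⟩, by rw [h₁.int 12 (by simp), hc]⟩
  · have : z ≤ z ^ 3 := Nat.le_self_pow (by simp) z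
    calc 12 * z + z * (z * (27 * z) + 4) = 27 * z ^ 3 + 16 * z := by ring
      _ ≤ 43 * z ^ 3 := by omega

end Combinatorial

/-! ### The greedy strategy profile -/

/-- The number of times `1` has to be doubled to exceed `L`. -/
noncomputable def doublings (L : ℝ) : ℕ :=
  Nat.find (pow_unbounded_of_one_lt L one_lt_two)

/-- An approximation of `ξ * (1 + L) ^ (α - 1)` that can be computed by repeated doubling. -/
noncomputable def roundedWeight (α ξ L : ℝ) : ℝ :=
  ξ * 2 ^ ⌊doublings L * (α - 1)⌋₊

lemma roundedWeight_pos {α ξ : ℝ} (hξ : 0 < ξ) (L : ℝ) : 0 < roundedWeight α ξ L := by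
  unfold roundedWeight; positivity

namespace BayesianRouting

variable (I : BayesianRouting) (α : ℝ)

/-- The expected number of agents with numbers below `k` that use the edge `e`, when each agent
in turn takes for each type a lightest path for the rounded marginal costs at the expected load of
the preceding agents. -/
noncomputable def greedyLoad : ℕ → Fin I.numEdges → ℝ
  | 0 => fun _ => 0
  | k + 1 => fun e => greedyLoad k e + if h : k < I.numAgents then
      ∑ t, if e ∈ Network.shortestPath (G := I.toNetwork)
          (fun e => roundedWeight α (I.speed e) (greedyLoad k e))
          (I.source ⟨k, h⟩ t) (I.sink ⟨k, h⟩ t) then I.prior ⟨k, h⟩ t else 0 else 0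

/-- The edge weights for which agent `k` takes shortest paths. -/
noncomputable def greedyWeight (k : ℕ) (e : Fin I.numEdges) : ℝ :=
  roundedWeight α (I.speed e) (I.greedyLoad α k e)

/-- The path taken by type `t` of agent `i`. -/
noncomputable def greedyPath (i : Fin I.numAgents) (t : Fin (I.numTypes i)) :
    Finset (Fin I.numEdges) :=
  Network.shortestPath (G := I.toNetwork) (I.greedyWeight α i) (I.source i t) (I.sink i t)

lemma greedyWeight_pos (k : ℕ) (e : Fin I.numEdges) : 0 < I.greedyWeight α k e :=
  roundedWeight_pos (I.speed_pos e) _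

/-- The strategy profile in which the agents in turn choose lightest paths. -/
noncomputable def greedyStrategy : I.StrategyProfile := fun i t =>
  ⟨I.greedyPath α i t, (Network.shortestPath_spec (I.greedyWeight_pos α i)
    (I.feasible i t).choose_spec).1⟩

/-- The probability that agent `i` uses the edge `e`. -/
noncomputable def greedyUse (i : Fin I.numAgents) (e : Fin I.numEdges) : ℝ :=
  ∑ t, if e ∈ I.greedyPath α i t then I.prior i t else 0

lemma greedyLoad_succ {k : ℕ} (h : k < I.numAgents) (e : Fin I.numEdges) :
    I.greedyLoad α (k + 1) e = I.greedyLoad α k e + I.greedyUse α ⟨k, h⟩ e := by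
  simp only [greedyLoad, dif_pos h]
  rfl

lemma greedyUse_nonneg (i : Fin I.numAgents) (e : Fin I.numEdges) : 0 ≤ I.greedyUse α i e :=
  Finset.sum_nonneg fun t _ => by split_ifs; exacts [I.prior_nonneg i t, le_rfl]

lemma greedyUse_le_one (i : Fin I.numAgents) (e : Fin I.numEdges) : I.greedyUse α i e ≤ 1 := by
  rw [← I.prior_sum i]
  refine Finset.sum_le_sum fun t _ => ?_
  split_ifs
  exacts [le_rfl, I.prior_nonneg i t]

lemma greedyLoad_mono (e : Fin I.numEdges) : Monotone fun k => I.greedyLoad α k e := by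
  refine monotone_nat_of_le_succ fun k => ?_
  by_cases h : k < I.numAgents
  · rw [greedyLoad_succ _ _ h]
    linarith [I.greedyUse_nonneg α ⟨k, h⟩ e]
  · simp [greedyLoad, h]

lemma greedyLoad_nonneg (k : ℕ) (e : Fin I.numEdges) : 0 ≤ I.greedyLoad α k e :=
  I.greedyLoad_mono α e (Nat.zero_le k)

lemma greedyLoad_le {k : ℕ} (h : k ≤ I.numAgents) (e : Fin I.numEdges) :
    I.greedyLoad α k e ≤ k := by
  induction k with
  | zero => simp [greedyLoad]
  | succ k ih =>
    rw [greedyLoad_succ _ _ h]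
    push_cast
    linarith [ih (by omega), I.greedyUse_le_one α ⟨k, h⟩ e]

end BayesianRouting

/-! ### The program for the greedy strategy profile -/

namespace Combinatorial

open IntExpr in
/-- Double the weight of the edge in variable 13 as often as the real in array 7 allows. -/
def doubleWeightProgram : Program :=
  .loop (.neg (.realLt (.read 7 (lit 0) (lit 0) (lit 0)) (.lit 1)))
    (.seq (.setReal 7 (lit 0) (lit 0) (lit 0) (.sub (.read 7 (lit 0) (lit 0) (lit 0)) (.lit 1)))
      (.setReal 4 (var 13) (lit 0) (lit 0)
        (.add (.read 4 (var 13) (lit 0) (lit 0)) (.read 4 (var 13) (lit 0) (lit 0)))))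

open IntExpr in
/-- Double the threshold in the real array 6 until it exceeds the load of the edge in variable 13,
and the weight of this edge `α - 1` times as often, rounded down. -/
def doubleThresholdProgram : Program :=
  .loop (.neg (.realLt (.read 3 (var 13) (lit 0) (lit 0)) (.read 6 (lit 0) (lit 0) (lit 0))))
    (.seq (.setReal 6 (lit 0) (lit 0) (lit 0)
        (.add (.read 6 (lit 0) (lit 0) (lit 0)) (.read 6 (lit 0) (lit 0) (lit 0))))
      (.seq (.setReal 7 (lit 0) (lit 0) (lit 0)
          (.add (.read 7 (lit 0) (lit 0) (lit 0))
            (.sub (.read 0 (lit 0) (lit 0) (lit 0)) (.lit 1))))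
        doubleWeightProgram))

open IntExpr in
/-- Compute the rounded weight of the edge in variable 13. The real array 3 holds the loads, the
real arrays 4, 6 and 7 the weights, the current power of two, and the difference between its
exponent times `α - 1` and the number of doublings of the weight. -/
def edgeWeightProgram : Program :=
  .seq (.setReal 4 (var 13) (lit 0) (lit 0) (.read 1 (var 13) (lit 0) (lit 0)))
    (.seq (.setReal 6 (lit 0) (lit 0) (lit 0) (.lit 1))
      (.seq (.setReal 7 (lit 0) (lit 0) (lit 0) (.lit 0)) doubleThresholdProgram))

open IntExpr in
/-- Compute the weights of all edges. All weights are computed before the loads change, so the types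
of an agent do not influence each other. -/
def weightProgram : Program :=
  .forLoop 13 (read 0 (lit 2) (lit 0) (lit 0)) edgeWeightProgram

open IntExpr in
/-- Copy the path to the node in variable 22 to the output, for the agent in variable 10 and the
type in variable 11, and add its probability to the loads. -/
def recordProgram : Program :=
  .forLoop 13 (read 0 (lit 2) (lit 0) (lit 0))
    (.branch (.intLt (lit 0) (read 6 (var 22) (var 13) (lit 0)))
      (.seq (.setInt 4 (var 10) (var 11) (var 13) (lit 1))
        (.setReal 3 (var 13) (lit 0) (lit 0)
          (.add (.read 3 (var 13) (lit 0) (lit 0)) (.read 2 (var 10) (var 11) (lit 0)))))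
      .skip)

open IntExpr in
/-- Choose the path for the type in variable 11 of the agent in variable 10. -/
def typeProgram : Program :=
  .seq (.setInt 22 (lit 0) (lit 0) (lit 0) (read 3 (var 10) (var 11) (lit 0)))
    (.seq bellmanFordProgram
      (.seq (.setInt 22 (lit 0) (lit 0) (lit 0) (read 3 (var 10) (var 11) (lit 1)))
        recordProgram))

open IntExpr in
/-- The greedy algorithm: for each agent (variable 10), compute the edge weights, then choose a
path for each type (variable 11). -/
def greedyProgram : Program :=
  .forLoop 10 (read 0 (lit 0) (lit 0) (lit 0))
    (.seq weightProgram (.forLoop 11 (read 2 (var 10) (lit 0) (lit 0)) typeProgram))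

/-- The input has not been overwritten. -/
structure KeepsInput (s : State) (α : ℝ) (I : BayesianRouting) : Prop where
  int : ∀ a < 4, s.int a = (input α I).int a
  real : ∀ a < 3, s.real a = (input α I).real a

variable {s s' : State} {I : BayesianRouting} {α : ℝ} {A B : List ℕ} {z : ℕ}

namespace KeepsInput

lemma frame (h : KeepsInput s α I) (hf : Frame A B s s') (hA : ∀ a ∈ A, 4 ≤ a := by simp)
    (hB : ∀ a ∈ B, 3 ≤ a := by simp) : KeepsInput s' α I :=
  ⟨fun a ha => by rw [hf.int a fun h => by have := hA a h; omega, h.int a ha],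
    fun a ha => by rw [hf.real a fun h => by have := hB a h; omega, h.real a ha]⟩

lemma agents (h : KeepsInput s α I) : s.int 0 0 0 0 = I.numAgents := by
  rw [h.int 0 (by simp)]; simp [input]

lemma nodes (h : KeepsInput s α I) : s.int 0 1 0 0 = I.numNodes := by
  rw [h.int 0 (by simp)]; simp [input]

lemma edges (h : KeepsInput s α I) : s.int 0 2 0 0 = I.numEdges := by
  rw [h.int 0 (by simp)]; simp [input]

lemma directed (h : KeepsInput s α I) :
    s.int 0 3 0 0 = if I.directed = true then 1 else 0 := by
  rw [h.int 0 (by simp)]; simp [input]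

lemma src (h : KeepsInput s α I) (e : Fin I.numEdges) : s.int 1 e 0 0 = I.src e := by
  rw [h.int 1 (by simp)]; simp [input]

lemma tgt (h : KeepsInput s α I) (e : Fin I.numEdges) : s.int 1 e 1 0 = I.tgt e := by
  rw [h.int 1 (by simp)]; simp [input]

lemma types (h : KeepsInput s α I) (i : Fin I.numAgents) : s.int 2 i 0 0 = I.numTypes i := by
  rw [h.int 2 (by simp)]; simp [input]

lemma source (h : KeepsInput s α I) (i : Fin I.numAgents)
    (t : Fin (I.numTypes i)) : s.int 3 i t 0 = I.source i t := by
  rw [h.int 3 (by simp)]; simp [input]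

lemma sink (h : KeepsInput s α I) (i : Fin I.numAgents)
    (t : Fin (I.numTypes i)) : s.int 3 i t 1 = I.sink i t := by
  rw [h.int 3 (by simp)]; simp [input]

lemma exponent (h : KeepsInput s α I) : s.real 0 0 0 0 = α := by
  rw [h.real 0 (by simp)]; simp [input]

lemma speed (h : KeepsInput s α I) (e : Fin I.numEdges) : s.real 1 e 0 0 = I.speed e := by
  rw [h.real 1 (by simp)]; simp [input]

lemma prior (h : KeepsInput s α I) (i : Fin I.numAgents)
    (t : Fin (I.numTypes i)) : s.real 2 i t 0 = I.prior i t := by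
  rw [h.real 2 (by simp)]; simp [input]

end KeepsInput

lemma runs_edgeWeightProgram (hα : 1 < α) (hI : KeepsInput s α I) {e : Fin I.numEdges} {L : ℝ}
    (he : s.int 13 0 0 0 = e) (hL : s.real 3 e 0 0 = L) (hLz : L ≤ z) (hz : 1 ≤ z) :
    Runs edgeWeightProgram s (z * (3 * ⌈α⌉₊ + 8)) fun s' => Frame [] [4, 6, 7] s s' ∧
      ∀ e', s'.real 4 e' 0 0 = if e' = e then roundedWeight α (I.speed e) L
        else s.real 4 e' 0 0 := by
  -- After `k` doublings of the threshold and `j` doublings of the weight: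
  let W (k j : ℕ) (s' : State) : Prop := Frame [] [4, 6, 7] s s' ∧
    (∀ e', s'.real 4 e' 0 0 = if e' = e then I.speed e * 2 ^ j else s.real 4 e' 0 0) ∧
    s'.real 6 0 0 0 = 2 ^ k ∧ s'.real 7 0 0 0 = k * (α - 1) - j
  have h₀ : W 0 0 (((s.setReal 4 e 0 0 (s.real 1 e 0 0)).setReal 6 0 0 0 (1 : ℕ)).setReal
      7 0 0 0 (0 : ℕ)) := by
    refine ⟨(((Frame.refl _ _ s).setReal _ _ _ _ _).setReal _ _ _ _ _).setReal _ _ _ _ _,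
      fun e' => ?_, ?_, ?_⟩ <;> simp [State.setReal_real_of_ne, hI.speed]
  have inner : ∀ k s', W (k + 1) ⌊k * (α - 1)⌋₊ s' →
      Runs doubleWeightProgram s' (⌈α⌉₊ * (2 + 1) + 1)
        (W (k + 1) ⌊(k + 1 : ℕ) * (α - 1)⌋₊) := by
    intro k s' hs'
    have hk : (0 : ℝ) ≤ k * (α - 1) := mul_nonneg (by positivity) (by linarith)
    refine Runs.loop (Inv := fun m s' => W (k + 1) (⌊k * (α - 1)⌋₊ + m) s' ∧
      ((⌊k * (α - 1)⌋₊ + m : ℕ) : ℝ) ≤ (k + 1 : ℕ) * (α - 1)) ⟨hs', ?_⟩ ?_ ?_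
    · have := Nat.floor_le hk
      push_cast
      linarith
    · rintro m s₁ ⟨⟨hf, h₄, h₆, h₇⟩, hm⟩ hb
      have h13 : s₁.int 13 0 0 0 = e := by rw [hf.int 13 (by simp), he]
      simp only [Test.holds_neg, Test.holds_realLt, RealExpr.eval_read, IntExpr.eval_lit,
        RealExpr.eval_lit, h₇, not_lt] at hb
      constructor
      · -- The fractional part of `k * (α - 1)` is below `1`, so fewer than `α` units fit.
        have := Nat.lt_floor_add_one (k * (α - 1))
        push_cast at hb
        rw [Nat.lt_ceil]
        linarith
      · refine Runs.setReal_seq (Runs.setReal ⟨⟨(hf.setReal _ _ _ _ _).setReal _ _ _ _ _,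
          fun e' => ?_, ?_, ?_⟩, ?_⟩)
        · by_cases he' : e' = e
          · simp [State.setReal_real_of_ne, h13, h₄, he', pow_add]
            ring
          · simp [State.setReal_real_of_ne, h13, h₄, he']
        · simp [State.setReal_real_of_ne, h₆]
        · simp [State.setReal_real_of_ne, h₇]
          ring
        · push_cast at hb ⊢
          linarith
    · rintro m s₁ ⟨hW, hm⟩ hb
      simp only [Test.holds_neg, Test.holds_realLt, RealExpr.eval_read, IntExpr.eval_lit,
        RealExpr.eval_lit, hW.2.2.2, not_not] at hb
      rwa [(Nat.floor_eq_iff (le_trans (by positivity) hm)).2 ⟨hm, by push_cast at hb ⊢; linarith⟩]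
  have outer : Runs doubleThresholdProgram (((s.setReal 4 e 0 0 (s.real 1 e 0 0)).setReal 6 0 0 0
      (1 : ℕ)).setReal 7 0 0 0 (0 : ℕ)) (z * (⌈α⌉₊ * (2 + 1) + 1 + 1 + 1 + 1) + 1)
      (W (doublings L) ⌊doublings L * (α - 1)⌋₊) := by
    refine Runs.loop
      (Inv := fun k s' => W k ⌊k * (α - 1)⌋₊ s' ∧ ∀ k' < k, (2 : ℝ) ^ k' ≤ L)
      ⟨by simpa using h₀, by simp⟩ ?_ ?_
    · rintro k s₁ ⟨⟨hf, h₄, h₆, h₇⟩, hk⟩ hb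
      have h13 : s₁.int 13 0 0 0 = e := by rw [hf.int 13 (by simp), he]
      simp only [Test.holds_neg, Test.holds_realLt, RealExpr.eval_read, IntExpr.eval_lit,
        IntExpr.eval_var, h13, hf.real 3 (by simp), hL, h₆, not_lt] at hb
      constructor
      · -- The loads are at most `z`, so `z` doublings suffice.
        have h₁ : (2 : ℝ) ^ k ≤ z := hb.trans hLz
        exact Nat.lt_two_pow_self.trans_le (by exact_mod_cast h₁)
      · refine Runs.setReal_seq (Runs.setReal_seq ((inner k _ ?_).mono le_rfl
          fun s₂ h₂ => ⟨h₂, ?_⟩))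
        · refine ⟨(hf.setReal _ _ _ _ _).setReal _ _ _ _ _, fun e' => ?_, ?_, ?_⟩
          · simp [State.setReal_real_of_ne, h₄]
          · simp [State.setReal_real_of_ne, h₆, pow_succ]
            ring
          · simp [State.setReal_real_of_ne, h₇, hf.real 0, hI.exponent]
            ring
        · intro k' hk'
          rcases Nat.lt_succ_iff_lt_or_eq.1 hk' with h | rfl
          exacts [hk k' h, hb]
    · rintro k s₁ ⟨hW, hk⟩ hb
      have h13 : s₁.int 13 0 0 0 = e := by rw [hW.1.int 13 (by simp), he]
      simp only [Test.holds_neg, Test.holds_realLt, RealExpr.eval_read, IntExpr.eval_lit,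
        IntExpr.eval_var, h13, hW.1.real 3 (by simp), hL, hW.2.2.1, not_not] at hb
      have : doublings L = k := (Nat.find_eq_iff _).2 ⟨hb, fun k' h => not_lt.2 (hk k' h)⟩
      rwa [this]
  have h := Runs.setReal_seq (a := 4) (i := .var 13) (j := .lit 0) (k := .lit 0)
    (x := .read 1 (.var 13) (.lit 0) (.lit 0)) (s := s) (Runs.setReal_seq (a := 6) (i := .lit 0)
    (j := .lit 0) (k := .lit 0) (x := .lit 1) (Runs.setReal_seq (a := 7) (i := .lit 0)
    (j := .lit 0) (k := .lit 0) (x := .lit 0) (by simpa only [IntExpr.eval_var, IntExpr.eval_lit,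
      RealExpr.eval_read, RealExpr.eval_lit, State.setReal_int, he] using outer)))
  exact h.mono (by nlinarith) fun s' h => ⟨h.1, h.2.1⟩

end Combinatorial

namespace Combinatorial

variable {s s' : State} {I : BayesianRouting} {α : ℝ} {A B : List ℕ} {z : ℕ}

lemma HoldsTable.shortestPath {G : Network} {w : Fin G.numEdges → ℝ} {u v : Fin G.numNodes}
    (h : HoldsTable s w (Network.bellmanFord w u G.numNodes)) {a : Finset (Fin G.numEdges)}
    (ha : G.IsPathSet u v a) (e : Fin G.numEdges) :
    0 < s.int 6 v e 0 ↔ e ∈ Network.shortestPath w u v := by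
  obtain ⟨l, hl⟩ := ha.exists_bellmanFord w
  rw [((h v).2 l hl).2.2 e]
  simp [Network.shortestPath, hl]

lemma runs_weightProgram (hα : 1 < α) (hI : KeepsInput s α I) {k : ℕ} (hk : k ≤ I.numAgents)
    (hL : ∀ e : Fin I.numEdges, s.real 3 e 0 0 = I.greedyLoad α k e) (hz : 1 ≤ z)
    (hN : I.numAgents ≤ z) (hM : I.numEdges ≤ z) :
    Runs weightProgram s (z ^ 2 * (3 * ⌈α⌉₊ + 12)) fun s' => Frame [13] [4, 6, 7] s s' ∧
      Presents s' I.toNetwork (I.greedyWeight α k) := by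
  refine (Runs.forLoop (m := I.numEdges) (fun m s' => Frame [13] [4, 6, 7] s s' ∧
    ∀ e : Fin I.numEdges, e < m → s'.real 4 e 0 0 = I.greedyWeight α k e)
    (B := z * (3 * ⌈α⌉₊ + 8)) hM hz ?_ ?_ ?_ ?_ ?_).mono (by nlinarith) fun _ => id
  · rintro m s' v ⟨h, h'⟩
    exact ⟨h.setInt _ _ _ _ _, h'⟩
  · exact ⟨Frame.refl _ _ _, by simp⟩
  · rintro m s' ⟨h, h'⟩
    simpa using (hI.frame h).edges
  · rintro m s' hm ⟨h, h'⟩ hc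
    refine (runs_edgeWeightProgram hα (hI.frame h) (e := ⟨m, hm⟩) (L := I.greedyLoad α k ⟨m, hm⟩)
      (z := z) hc ?_ ?_ hz).mono le_rfl ?_
    · rw [h.real 3 (by simp)]
      exact hL ⟨m, hm⟩
    · exact (I.greedyLoad_le α hk _).trans (by exact_mod_cast hk.trans hN)
    · rintro s'' ⟨h₁, h₂⟩
      refine ⟨⟨h.trans h₁, fun e he => ?_⟩, by rw [h₁.int 13 (by simp), hc]⟩
      rw [h₂]
      split_ifs with hem
      · obtain rfl : e = ⟨m, hm⟩ := Fin.ext hem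
        rfl
      · exact h' e (by simp only at hem; omega)
  · rintro s' ⟨h, h'⟩
    have hI' := hI.frame h
    exact ⟨h, hI'.nodes, hI'.edges, hI'.directed, hI'.src, hI'.tgt, fun e => h' e e.2⟩

/-- The expected load of the edge `e` due to the agents before `i` and the first `k` types of agent
`i`. -/
noncomputable def partialLoad (α : ℝ) (I : BayesianRouting) (i : Fin I.numAgents) (k : ℕ)
    (e : Fin I.numEdges) : ℝ :=
  I.greedyLoad α i e + ∑ t with t.1 < k, if e ∈ I.greedyPath α i t then I.prior i t else 0

lemma partialLoad_zero (i : Fin I.numAgents) (e : Fin I.numEdges) :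
    partialLoad α I i 0 e = I.greedyLoad α i e := by
  simp [partialLoad]

lemma partialLoad_succ (i : Fin I.numAgents) (t : Fin (I.numTypes i)) (e : Fin I.numEdges) :
    partialLoad α I i (t + 1) e = partialLoad α I i t e +
      if e ∈ I.greedyPath α i t then I.prior i t else 0 := by
  have : (Finset.univ.filter fun t' : Fin (I.numTypes i) => t'.1 < t + 1) =
      insert t (Finset.univ.filter fun t' : Fin (I.numTypes i) => t'.1 < t) := by
    ext t'
    simp [Fin.ext_iff]
    omega
  rw [partialLoad, this, Finset.sum_insert (by simp), partialLoad]
  ring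

lemma partialLoad_numTypes (i : Fin I.numAgents) (e : Fin I.numEdges) :
    partialLoad α I i (I.numTypes i) e = I.greedyLoad α (i + 1) e := by
  rw [I.greedyLoad_succ α i.2]
  simp [partialLoad, BayesianRouting.greedyUse]

/-- The output array holds the greedy paths for the requests that are `done`. -/
def HoldsPaths (s : State) (α : ℝ) (I : BayesianRouting) (done : ℕ → ℕ → ℕ → Prop) : Prop :=
  ∀ (i : Fin I.numAgents) (t : Fin (I.numTypes i)) (e : Fin I.numEdges),
    0 < s.int 4 i t e ↔ done i t e ∧ e ∈ I.greedyPath α i t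

lemma HoldsPaths.frame {D D' : ℕ → ℕ → ℕ → Prop} (h : HoldsPaths s α I D) (hf : Frame A B s s')
    (hD : ∀ (i : Fin I.numAgents) (t : Fin (I.numTypes i)) (e : Fin I.numEdges),
      D i t e ↔ D' i t e) (hA : 4 ∉ A := by simp) : HoldsPaths s' α I D' := by
  intro i t e
  rw [hf.int 4 hA, ← hD]
  exact h i t e

lemma runs_recordProgram (hI : KeepsInput s α I) {i : Fin I.numAgents} {t : Fin (I.numTypes i)}
    (hi : s.int 10 0 0 0 = i) (ht : s.int 11 0 0 0 = t)
    (hpath : ∀ e : Fin I.numEdges, 0 < s.int 6 (s.int 22 0 0 0) e 0 ↔ e ∈ I.greedyPath α i t)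
    (hL : ∀ e : Fin I.numEdges, s.real 3 e 0 0 = partialLoad α I i t e)
    (hO : HoldsPaths s α I fun i' t' _ => i' < i ∨ i' = i ∧ t' < t)
    (hz : 1 ≤ z) (hM : I.numEdges ≤ z) :
    Runs recordProgram s (7 * z) fun s' => Frame [4, 13] [3] s s' ∧
      (∀ e : Fin I.numEdges, s'.real 3 e 0 0 = partialLoad α I i (t + 1) e) ∧
      HoldsPaths s' α I fun i' t' _ => i' < i ∨ i' = i ∧ t' < t + 1 := by
  refine (Runs.forLoop (m := I.numEdges) (fun m s' => Frame [4, 13] [3] s s' ∧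
    (∀ e : Fin I.numEdges, s'.real 3 e 0 0 = partialLoad α I i (if e < m then t + 1 else t) e) ∧
    HoldsPaths s' α I fun i' t' e => i' < i ∨ i' = i ∧ (t' < t ∨ t' = t ∧ e < m))
    (B := 3) hM hz ?_ ?_ ?_ ?_ ?_).mono (by omega) fun _ => id
  · rintro m s' v ⟨h, h', h''⟩
    exact ⟨h.setInt _ _ _ _ _, h', h''.frame ((Frame.refl [13] [] _).setInt _ _ _ _ _)
      fun _ _ _ => Iff.rfl⟩
  · exact ⟨Frame.refl _ _ _, by simpa using hL, by simpa using hO⟩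
  · rintro m s' ⟨h, h'⟩
    simpa using (hI.frame h).edges
  · rintro m s' hm ⟨h, h', h''⟩ hc
    have hi' : s'.int 10 0 0 0 = i := by rw [h.int 10 (by simp), hi]
    have ht' : s'.int 11 0 0 0 = t := by rw [h.int 11 (by simp), ht]
    have htest : (Test.intLt (.lit 0) (.read 6 (.var 22) (.var 13) (.lit 0))).Holds s' ↔
        (⟨m, hm⟩ : Fin I.numEdges) ∈ I.greedyPath α i t := by
      rw [← hpath]
      simp [hc, h.int 6, h.int 22]
    refine Runs.branch (B := 2) (fun hb => ?_) fun hb => ?_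
    · rw [htest] at hb
      refine Runs.setInt_seq (Runs.setReal ?_)
      simp only [IntExpr.eval_var, IntExpr.eval_lit, RealExpr.eval_add, RealExpr.eval_read, hi',
        ht', hc, State.setInt_real, State.setInt_int_of_ne _ _ _ _ (show 13 ≠ 4 by simp),
        State.setInt_int_of_ne _ _ _ _ (show 10 ≠ 4 by simp),
        State.setInt_int_of_ne _ _ _ _ (show 11 ≠ 4 by simp), State.setReal_int, and_true]
      refine ⟨(h.setInt _ _ _ _ _).setReal _ _ _ _ _, fun e => ?_, fun i' t₁ e => ?_⟩
      · by_cases he : e = ⟨m, hm⟩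
        · subst he
          have h₃ := h' ⟨m, hm⟩
          simp only [lt_irrefl, if_false] at h₃
          simp [h₃, partialLoad_succ, hb, (hI.frame h).prior]
        · have he' : (e : ℕ) ≠ m := fun h => he (Fin.ext h)
          have : (e : ℕ) < m + 1 ↔ e < m := by omega
          simp [he', this, h']
      · by_cases hit : (i' : ℕ) = i ∧ (t₁ : ℕ) = t ∧ (e : ℕ) = m
        · obtain ⟨h₁, h₂, h₃⟩ := hit
          obtain rfl : i' = i := Fin.ext h₁
          obtain rfl : t₁ = t := Fin.ext h₂
          obtain rfl : e = ⟨m, hm⟩ := Fin.ext h₃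
          simp [hb]
        · simp only [State.setReal_int, State.setInt_int_same, hit, if_false, h'' i' t₁ e]
          refine and_congr_left fun _ => ?_
          omega
    · rw [htest] at hb
      refine (Runs.skip ?_).mono (by omega) fun _ => id
      refine ⟨⟨h, fun e => ?_, fun i' t₁ e => ?_⟩, hc⟩
      · rw [h' e]
        by_cases he : e = ⟨m, hm⟩
        · subst he
          simp [partialLoad_succ, hb]
        · have he' : (e : ℕ) ≠ m := fun h => he (Fin.ext h)
          have : (e : ℕ) < m + 1 ↔ e < m := by omega
          simp [this]
      · rw [h'' i' t₁ e]
        by_cases hit : (i' : ℕ) = i ∧ (t₁ : ℕ) = t ∧ (e : ℕ) = m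
        · obtain ⟨h₁, h₂, h₃⟩ := hit
          obtain rfl : i' = i := Fin.ext h₁
          obtain rfl : t₁ = t := Fin.ext h₂
          obtain rfl : e = ⟨m, hm⟩ := Fin.ext h₃
          simp [hb]
        · refine and_congr_left fun _ => ?_
          omega
  · rintro s' ⟨h, h', h''⟩
    refine ⟨h, fun e => by simpa using h' e, h''.frame (Frame.refl [] [] _) fun i' t' e => ?_⟩
    have := e.2
    omega

lemma runs_typeProgram (hI : KeepsInput s α I) {i : Fin I.numAgents} {t : Fin (I.numTypes i)}
    (hE : Presents s I.toNetwork (I.greedyWeight α i))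
    (hi : s.int 10 0 0 0 = i) (ht : s.int 11 0 0 0 = t)
    (hL : ∀ e : Fin I.numEdges, s.real 3 e 0 0 = partialLoad α I i t e)
    (hO : HoldsPaths s α I fun i' t' _ => i' < i ∨ i' = i ∧ t' < t)
    (hz : 1 ≤ z) (hn : I.numNodes ≤ z) (hM : I.numEdges ≤ z) :
    Runs typeProgram s (52 * z ^ 3) fun s' =>
      Frame [4, 5, 6, 12, 13, 14, 20, 21, 22] [3, 5] s s' ∧
      (∀ e : Fin I.numEdges, s'.real 3 e 0 0 = partialLoad α I i (t + 1) e) ∧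
      HoldsPaths s' α I fun i' t' _ => i' < i ∨ i' = i ∧ t' < t + 1 := by
  have hzz : z ≤ z ^ 3 := Nat.le_self_pow (by simp) z
  refine (Runs.setInt_seq (Runs.seq (B₂ := 7 * z + 1) (runs_bellmanFordProgram
    (z := z) (hE.frame ((Frame.refl [22] [] _).setInt _ _ _ _ _)) hz hn hM (u := I.source i t) ?_)
    ?_ le_rfl)).mono (by omega) fun _ => id
  · simp [hi, ht, hI.source]
  rintro s₁ ⟨hf, hT⟩
  have hf₁ : Frame [5, 6, 12, 13, 14, 20, 21, 22] [5] s s₁ :=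
    ((Frame.refl [22] [] _).setInt _ _ _ _ _).trans hf
  have hf₂ := hf₁.setInt 22 0 0 0 (I.sink i t)
  refine Runs.setInt_seq ?_
  simp only [IntExpr.eval_var, IntExpr.eval_lit, IntExpr.eval_read, hf₁.int 10 (by simp),
    hf₁.int 11 (by simp), hi, ht, (hI.frame hf₁).sink]
  refine (runs_recordProgram (α := α) (hI.frame hf₂) (i := i) (t := t) ?_ ?_ ?_ ?_ ?_ hz hM).mono
    le_rfl ?_
  · rw [hf₂.int 10 (by simp), hi]
  · rw [hf₂.int 11 (by simp), ht]
  · intro e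
    obtain ⟨a, ha⟩ := I.feasible i t
    rw [State.setInt_int_of_ne _ _ _ _ (show 6 ≠ 22 by simp)]
    simpa [BayesianRouting.greedyPath] using hT.shortestPath ha e
  · intro e
    rw [hf₂.real 3 (by simp), hL]
  · exact hO.frame hf₂ fun _ _ _ => Iff.rfl
  · rintro s' ⟨h, h'⟩
    exact ⟨hf₂.trans h, h'⟩

lemma runs_greedyProgram (hα : 1 < α) (I : BayesianRouting) (hz : 1 ≤ z) (hN : I.numAgents ≤ z)
    (hn : I.numNodes ≤ z) (hM : I.numEdges ≤ z) (ht : ∀ i, I.numTypes i ≤ z) :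
    Runs greedyProgram (input α I) ((3 * ⌈α⌉₊ + 72) * z ^ 5) fun s' =>
      IsOutput I s' (I.greedyStrategy α) := by
  have hI₀ : KeepsInput (input α I) α I := ⟨fun _ _ => rfl, fun _ _ => rfl⟩
  refine (Runs.forLoop (m := I.numAgents) (fun k s' =>
    Frame [4, 5, 6, 10, 11, 12, 13, 14, 20, 21, 22] [3, 4, 5, 6, 7] (input α I) s' ∧
    (∀ e : Fin I.numEdges, s'.real 3 e 0 0 = I.greedyLoad α k e) ∧
    HoldsPaths s' α I fun i' _ _ => i' < k)
    (B := z ^ 2 * (3 * ⌈α⌉₊ + 12) + z * (52 * z ^ 3 + 4)) hN hz ?_ ?_ ?_ ?_ ?_).mono ?_ fun _ => id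
  · rintro m s' v ⟨h, h', h''⟩
    exact ⟨h.setInt _ _ _ _ _, h', h''.frame ((Frame.refl [10] [] _).setInt _ _ _ _ _)
      fun _ _ _ => Iff.rfl⟩
  · exact ⟨Frame.refl _ _ _, by simp [input, BayesianRouting.greedyLoad],
      by simp [HoldsPaths, input]⟩
  · rintro m s' ⟨h, -⟩
    simpa using (hI₀.frame h).agents
  · rintro k s₁ hk ⟨hf₁, hL, hO⟩ hc
    have hI₁ := hI₀.frame hf₁
    refine Runs.seq (runs_weightProgram hα hI₁ hk.le hL hz hN hM) ?_ le_rfl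
    rintro s₂ ⟨hf₂, hE⟩
    have hI₂ := hI₁.frame hf₂
    refine Runs.forLoop (m := I.numTypes ⟨k, hk⟩) (fun t s' =>
      Frame [4, 5, 6, 11, 12, 13, 14, 20, 21, 22] [3, 5] s₂ s' ∧
      (∀ e : Fin I.numEdges, s'.real 3 e 0 0 = partialLoad α I ⟨k, hk⟩ t e) ∧
      HoldsPaths s' α I fun i' t' _ => i' < k ∨ i' = k ∧ t' < t) (ht _) hz ?_ ?_ ?_ ?_ ?_
    · rintro m s' v ⟨h, h', h''⟩
      exact ⟨h.setInt _ _ _ _ _, h', h''.frame ((Frame.refl [11] [] _).setInt _ _ _ _ _)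
        fun _ _ _ => Iff.rfl⟩
    · refine ⟨Frame.refl _ _ _, fun e => ?_, hO.frame hf₂ (by simp)⟩
      rw [hf₂.real 3 (by simp), hL, partialLoad_zero]
    · rintro t s' ⟨h, -⟩
      have h10 : s'.int 10 0 0 0 = k := by rw [h.int 10 (by simp), hf₂.int 10 (by simp), hc]
      simpa [h10] using (hI₂.frame h).types ⟨k, hk⟩
    · rintro t s' htk ⟨h, hL', hO'⟩ hct
      have h10 : s'.int 10 0 0 0 = k := by rw [h.int 10 (by simp), hf₂.int 10 (by simp), hc]
      refine (runs_typeProgram (hI₂.frame h) (i := ⟨k, hk⟩) (t := ⟨t, htk⟩) (hE.frame h) h10 hct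
        hL' hO' hz hn hM).mono le_rfl ?_
      rintro s'' ⟨h₁, h₂, h₃⟩
      exact ⟨⟨h.trans h₁, h₂, h₃⟩, by rw [h₁.int 11 (by simp), hct]⟩
    · rintro s' ⟨h, hL', hO'⟩
      refine ⟨⟨hf₁.trans (hf₂.trans h (A₁ := [4, 5, 6, 11, 12, 13, 14, 20, 21, 22])
        (B₁ := [3, 4, 5, 6, 7])), fun e => ?_,
        hO'.frame (Frame.refl [] [] _) fun i' t' e => ?_⟩, ?_⟩
      · rw [hL', partialLoad_numTypes]
      · constructor
        · omega
        · intro h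
          rcases Nat.lt_succ_iff_lt_or_eq.1 h with h | h
          · exact Or.inl h
          · obtain rfl : i' = ⟨k, hk⟩ := Fin.ext h
            exact Or.inr ⟨h, t'.2⟩
      · rw [h.int 10 (by simp), hf₂.int 10 (by simp), hc]
  · rintro s' ⟨-, -, hO⟩ i t e
    rw [← Nat.pos_iff_ne_zero, hO i t e]
    simp [BayesianRouting.greedyStrategy]
  · have h₁ : z ^ 3 ≤ z ^ 5 := Nat.pow_le_pow_right hz (by simp)
    have h₂ : z ^ 2 ≤ z ^ 5 := Nat.pow_le_pow_right hz (by simp)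
    have h₃ : z ≤ z ^ 5 := Nat.le_self_pow (by simp) z
    calc z * (z ^ 2 * (3 * ⌈α⌉₊ + 12) + z * (52 * z ^ 3 + 4) + 4)
        = (3 * ⌈α⌉₊ + 12) * z ^ 3 + 52 * z ^ 5 + 4 * z ^ 2 + 4 * z := by ring
      _ ≤ (3 * ⌈α⌉₊ + 12) * z ^ 5 + 52 * z ^ 5 + 4 * z ^ 5 + 4 * z ^ 5 := by gcongr
      _ = (3 * ⌈α⌉₊ + 72) * z ^ 5 := by ring

lemma computes_greedyStrategy :
    ComputesInStronglyPolyTime greedyProgram fun α I => I.greedyStrategy α := by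
  refine ⟨5, fun α => 3 * ⌈α⌉₊ + 72, fun α hα I => ?_⟩
  have ht : ∀ i, I.numTypes i ≤ ∑ i, I.numTypes i := fun i =>
    Finset.single_le_sum (fun _ _ => Nat.zero_le _) (Finset.mem_univ i)
  obtain ⟨s, n, h₁, h₂, h₃⟩ := runs_greedyProgram (z := I.size + 1) hα I (by omega)
    (by unfold BayesianRouting.size; omega) (by unfold BayesianRouting.size; omega)
    (by unfold BayesianRouting.size; omega)
    (fun i => by have := ht i; unfold BayesianRouting.size; omega)
  refine ⟨s, n, h₁, h₃, ?_⟩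
  have : (n : ℝ) ≤ ((3 * ⌈α⌉₊ + 72) * (I.size + 1) ^ 5 : ℕ) := by exact_mod_cast h₂
  simpa using this

end Combinatorial

/-! ### Expectations over type profiles -/

namespace BayesianRouting

variable (I : BayesianRouting) (α : ℝ)

lemma expect_mono {f g : I.TypeProfile → ℝ} (h : ∀ t, f t ≤ g t) : I.expect f ≤ I.expect g :=
  Finset.sum_le_sum fun t _ =>
    mul_le_mul_of_nonneg_left (h t) (Finset.prod_nonneg fun i _ => I.prior_nonneg i (t i))

lemma expect_add (f g : I.TypeProfile → ℝ) :
    I.expect (fun t => f t + g t) = I.expect f + I.expect g := by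
  simp [expect, mul_add, Finset.sum_add_distrib]

lemma expect_const_mul (c : ℝ) (f : I.TypeProfile → ℝ) :
    I.expect (fun t => c * f t) = c * I.expect f := by
  simp only [expect, Finset.mul_sum]
  exact Finset.sum_congr rfl fun t _ => by ring

lemma expect_sum {ι : Type*} (A : Finset ι) (f : ι → I.TypeProfile → ℝ) :
    I.expect (fun t => ∑ x ∈ A, f x t) = ∑ x ∈ A, I.expect (f x) := by
  simp only [expect, Finset.mul_sum]
  exact Finset.sum_comm

/-- Functions of the types of different agents are independent. -/
lemma expect_prod (f : (i : Fin I.numAgents) → Fin (I.numTypes i) → ℝ) :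
    I.expect (fun t => ∏ i, f i (t i)) = ∏ i, ∑ x, I.prior i x * f i x := by
  simp only [expect, ← Finset.prod_mul_distrib]
  rw [Finset.prod_univ_sum, Fintype.piFinset_univ]

lemma expect_const (c : ℝ) : I.expect (fun _ => c) = c := by
  have h := I.expect_prod fun _ _ => 1
  simp only [Finset.prod_const_one, mul_one, I.prior_sum] at h
  simpa [h] using I.expect_const_mul c fun _ => 1

lemma expect_marginal (i : Fin I.numAgents) (g : Fin (I.numTypes i) → ℝ) :
    I.expect (fun t => g (t i)) = ∑ x, I.prior i x * g x := by
  have h := I.expect_prod (Function.update (fun _ _ => 1) i g)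
  have h₁ : ∀ t : I.TypeProfile,
      ∏ j, Function.update (β := fun j => Fin (I.numTypes j) → ℝ) (fun _ _ => 1) i g j (t j) =
        g (t i) := fun t => by
    rw [Finset.prod_eq_single i (fun j _ hj => by simp [hj]) (by simp)]
    simp
  rw [Finset.prod_eq_single i (fun j _ hj => by simp [hj, I.prior_sum]) (by simp)] at h
  simpa [h₁] using h

/-! ### Moments of the load -/

/-- The expected load of the edge `e` in the greedy strategy profile. -/
noncomputable def finalLoad (e : Fin I.numEdges) : ℝ := I.greedyLoad α I.numAgents e

lemma finalLoad_nonneg (e : Fin I.numEdges) : 0 ≤ I.finalLoad α e := I.greedyLoad_nonneg α _ e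

lemma finalLoad_eq (e : Fin I.numEdges) : I.finalLoad α e = ∑ i, I.greedyUse α i e := by
  have h : ∀ k (hk : k ≤ I.numAgents),
      I.greedyLoad α k e = ∑ i : Fin k, I.greedyUse α (Fin.castLE hk i) e := by
    intro k hk
    induction k with
    | zero => simp [greedyLoad]
    | succ k ih =>
      rw [greedyLoad_succ _ _ hk, ih (by omega), Fin.sum_univ_castSucc]
      rfl
  exact h _ le_rfl

/-- The right-hand side vanishes at `0`, which makes the bound on the moments of the load linear for
small loads. -/
lemma rpow_le_exp_sub_one {α y : ℝ} (hα : 1 < α) (hy : 0 ≤ y) :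
    y ^ α ≤ 2 * (⌈α⌉₊).factorial * (Real.exp y - 1) := by
  have hf : (1 : ℝ) ≤ (⌈α⌉₊).factorial := by exact_mod_cast Nat.factorial_pos _
  have he := Real.add_one_le_exp y
  rcases le_total y 1 with h | h
  · calc y ^ α ≤ y := Real.rpow_le_self_of_le_one hy h hα.le
      _ ≤ Real.exp y - 1 := by linarith
      _ ≤ _ := le_mul_of_one_le_left (by linarith) (by linarith)
  · have h₁ : y ^ α ≤ y ^ ⌈α⌉₊ := by
      rw [← Real.rpow_natCast]
      exact Real.rpow_le_rpow_of_exponent_le h (Nat.le_ceil α)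
    have h₂ := Real.pow_div_factorial_le_exp y hy ⌈α⌉₊
    rw [div_le_iff₀ (by linarith)] at h₂
    nlinarith

/-- The number of agents that use the edge `e` in the greedy strategy profile. -/
noncomputable def greedyCount (t : I.TypeProfile) (e : Fin I.numEdges) : ℕ :=
  I.load (t := t) (fun i => I.greedyStrategy α i (t i)) e

lemma expect_exp_greedyCount_le {θ : ℝ} (hθ : 0 ≤ θ) (hθ₁ : θ ≤ 1) (e : Fin I.numEdges) :
    I.expect (fun t => Real.exp (θ * I.greedyCount α t e)) ≤
      Real.exp (2 * θ * I.finalLoad α e) := by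
  have hexp : Real.exp θ - 1 ≤ 2 * θ := by
    have := (abs_le.1 (Real.abs_exp_sub_one_sub_id_le (abs_le.2 ⟨by linarith, hθ₁⟩))).2
    nlinarith
  have h₁ : ∀ t : I.TypeProfile, Real.exp (θ * I.greedyCount α t e) =
      ∏ i, (1 + (if e ∈ I.greedyPath α i (t i) then 1 else 0) * (Real.exp θ - 1)) := by
    intro t
    rw [mul_comm, Real.exp_nat_mul, greedyCount, load, ← Finset.prod_const, Finset.prod_filter]
    refine Finset.prod_congr rfl fun i _ => ?_
    by_cases h : e ∈ I.greedyPath α i (t i) <;> simp [greedyStrategy, h]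
  simp only [h₁]
  rw [I.expect_prod fun i x => 1 + (if e ∈ I.greedyPath α i x then 1 else 0) * (Real.exp θ - 1),
    finalLoad_eq, Finset.mul_sum, Real.exp_sum]
  refine Finset.prod_le_prod (fun i _ => ?_) fun i _ => ?_
  · refine Finset.sum_nonneg fun x _ => mul_nonneg (I.prior_nonneg i x) ?_
    have := Real.one_le_exp hθ
    split_ifs <;> simp [Real.exp_nonneg]
  · have h₂ : ∑ x, I.prior i x * (1 + (if e ∈ I.greedyPath α i x then 1 else 0) *
        (Real.exp θ - 1)) = 1 + I.greedyUse α i e * (Real.exp θ - 1) := by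
      simp only [mul_add, mul_one, Finset.sum_add_distrib, I.prior_sum, greedyUse, Finset.sum_mul]
      congr 1
      refine Finset.sum_congr rfl fun x _ => ?_
      split_ifs <;> simp
    rw [h₂]
    have h₃ := I.greedyUse_nonneg α i e
    have h₄ := Real.add_one_le_exp (2 * θ * I.greedyUse α i e)
    nlinarith

/-- A sum of independent indicators with mean `Λ` has its moment of order `α` bounded in terms of
`Λ`: the power is dominated by an exponential at scale `1 + Λ`. -/
lemma expect_greedyCount_rpow_le {α : ℝ} (hα : 1 < α) (e : Fin I.numEdges) :
    I.expect (fun t => (I.greedyCount α t e : ℝ) ^ α) ≤ 4 * (⌈α⌉₊).factorial * Real.exp 2 *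
      (I.finalLoad α e * (1 + I.finalLoad α e) ^ (α - 1)) := by
  set Λ := I.finalLoad α e with hΛ
  have hΛ₀ : 0 ≤ Λ := I.finalLoad_nonneg α e
  set θ := 1 / (1 + Λ) with hθ
  have hθ₀ : 0 < θ := by positivity
  have hθ₁ : θ ≤ 1 := by rw [hθ, div_le_one (by positivity)]; linarith
  have hθΛ : θ * (1 + Λ) = 1 := by rw [hθ]; field_simp
  have hpt : ∀ t, (I.greedyCount α t e : ℝ) ^ α ≤ (1 + Λ) ^ α * (2 * (⌈α⌉₊).factorial) *
      (Real.exp (θ * I.greedyCount α t e) + -1) := by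
    intro t
    have h₁ : (I.greedyCount α t e : ℝ) = (1 + Λ) * (θ * I.greedyCount α t e) := by
      linear_combination -(I.greedyCount α t e : ℝ) * hθΛ
    calc (I.greedyCount α t e : ℝ) ^ α = (1 + Λ) ^ α * (θ * I.greedyCount α t e) ^ α := by
          rw [← Real.mul_rpow (by positivity) (by positivity), ← h₁]
      _ ≤ (1 + Λ) ^ α * (2 * (⌈α⌉₊).factorial * (Real.exp (θ * I.greedyCount α t e) - 1)) := by
          gcongr
          exact rpow_le_exp_sub_one hα (by positivity)
      _ = _ := by ring
  have hexp : Real.exp (2 * θ * Λ) - 1 ≤ 2 * θ * Λ * Real.exp 2 := by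
    have h₁ : 2 * θ * Λ ≤ 2 := by nlinarith
    have h₂ := Real.add_one_le_exp (-(2 * θ * Λ))
    have h₃ : Real.exp (2 * θ * Λ) * Real.exp (-(2 * θ * Λ)) = 1 := by
      rw [← Real.exp_add]; simp
    have h₄ := Real.exp_le_exp.2 h₁
    have h₅ := Real.exp_pos (2 * θ * Λ)
    have h₆ : 0 ≤ 2 * θ * Λ := by positivity
    nlinarith [mul_le_mul_of_nonneg_left h₂ h₅.le, mul_le_mul_of_nonneg_left h₄ h₆]
  have hpow : (1 + Λ) ^ α * θ = (1 + Λ) ^ (α - 1) := by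
    rw [Real.rpow_sub_one (by positivity), hθ]
    ring
  calc I.expect (fun t => (I.greedyCount α t e : ℝ) ^ α)
      ≤ (1 + Λ) ^ α * (2 * (⌈α⌉₊).factorial) *
        (I.expect (fun t => Real.exp (θ * I.greedyCount α t e)) + -1) := by
        refine (I.expect_mono hpt).trans_eq ?_
        rw [expect_const_mul, expect_add, expect_const]
    _ ≤ (1 + Λ) ^ α * (2 * (⌈α⌉₊).factorial) * (2 * θ * Λ * Real.exp 2) := by
        gcongr
        linarith [I.expect_exp_greedyCount_le α hθ₀.le hθ₁ e]
    _ = 4 * (⌈α⌉₊).factorial * Real.exp 2 * (Λ * ((1 + Λ) ^ α * θ)) := by ring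
    _ = _ := by rw [hpow]

end BayesianRouting

/-! ### Rounded weights -/

lemma lt_two_pow_doublings (L : ℝ) : L < 2 ^ doublings L :=
  Nat.find_spec (pow_unbounded_of_one_lt L one_lt_two)

lemma two_pow_doublings_le {L : ℝ} (hL : 0 ≤ L) : (2 : ℝ) ^ doublings L ≤ 2 * (1 + L) := by
  rcases h : doublings L with - | k
  · norm_num
    linarith
  · have : ¬ L < 2 ^ k := Nat.find_min (pow_unbounded_of_one_lt L one_lt_two)
      (show k < doublings L by omega)
    rw [pow_succ]
    linarith

lemma roundedWeight_le {α ξ L : ℝ} (hα : 1 < α) (hξ : 0 < ξ) (hL : 0 ≤ L) :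
    roundedWeight α ξ L ≤ 2 ^ (α - 1) * (ξ * (1 + L) ^ (α - 1)) := by
  have hβ : 0 ≤ α - 1 := by linarith
  have h : (2 : ℝ) ^ ⌊doublings L * (α - 1)⌋₊ ≤ 2 ^ (α - 1) * (1 + L) ^ (α - 1) := by
    calc (2 : ℝ) ^ ⌊doublings L * (α - 1)⌋₊ ≤ 2 ^ (doublings L * (α - 1)) := by
          rw [← Real.rpow_natCast]
          exact Real.rpow_le_rpow_of_exponent_le one_le_two (Nat.floor_le (by positivity))
      _ = (2 ^ doublings L) ^ (α - 1) := by rw [Real.rpow_mul zero_le_two, Real.rpow_natCast]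
      _ ≤ (2 * (1 + L)) ^ (α - 1) := by
          gcongr
          exact two_pow_doublings_le hL
      _ = _ := Real.mul_rpow zero_le_two (by positivity)
  unfold roundedWeight
  nlinarith [mul_le_mul_of_nonneg_left h hξ.le]

lemma le_roundedWeight {α ξ L : ℝ} (hα : 1 < α) (hξ : 0 < ξ) (hL : 0 ≤ L) :
    ξ * (1 + L) ^ (α - 1) ≤ 2 ^ α * roundedWeight α ξ L := by
  have hβ : 0 ≤ α - 1 := by linarith
  have h₁ : 1 + L ≤ 2 * 2 ^ doublings L := by
    have := lt_two_pow_doublings L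
    have : (1 : ℝ) ≤ 2 ^ doublings L := one_le_pow₀ one_le_two
    linarith
  have h : (1 + L) ^ (α - 1) ≤ 2 ^ α * 2 ^ ⌊doublings L * (α - 1)⌋₊ := by
    calc (1 + L) ^ (α - 1) ≤ (2 * 2 ^ doublings L) ^ (α - 1) := by gcongr
      _ = 2 ^ (α - 1) * 2 ^ (doublings L * (α - 1)) := by
          rw [Real.mul_rpow zero_le_two (by positivity), Real.rpow_mul zero_le_two,
            Real.rpow_natCast]
      _ ≤ 2 ^ (α - 1) * 2 ^ (⌊doublings L * (α - 1)⌋₊ + 1 : ℝ) := by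
          gcongr
          · exact one_le_two
          · exact (Nat.lt_floor_add_one _).le
      _ = 2 ^ α * 2 ^ ⌊doublings L * (α - 1)⌋₊ := by
          rw [Real.rpow_add_one two_ne_zero, Real.rpow_natCast, Real.rpow_sub_one two_ne_zero]
          ring
  unfold roundedWeight
  nlinarith [mul_le_mul_of_nonneg_left h hξ.le]

/-! ### The competitive ratio of the greedy strategy profile -/

/-- Convexity of `x ↦ x ^ α`: the increment is at most the slope at the right end. -/
lemma rpow_sub_rpow_le {α x q : ℝ} (hα : 1 < α) (hx : 1 ≤ x) (hq : 0 ≤ q) :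
    (x + q) ^ α - x ^ α ≤ α * (q * (x + q) ^ (α - 1)) := by
  have hM : 0 < x + q := by linarith
  have h := one_add_mul_self_le_rpow_one_add (s := -(q / (x + q)))
    (by rw [neg_le_neg_iff, div_le_one hM]; linarith) hα.le
  have hx' : x = (x + q) * (1 + -(q / (x + q))) := by field_simp; ring
  have h₁ : x ^ α = (x + q) ^ α * (1 + -(q / (x + q))) ^ α := by
    conv_lhs => rw [hx']
    refine Real.mul_rpow hM.le ?_
    rw [← sub_eq_add_neg, sub_nonneg, div_le_one hM]
    linarith
  have h₂ : (x + q) ^ (α - 1) = (x + q) ^ α / (x + q) := Real.rpow_sub_one hM.ne' α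
  have h₃ := mul_le_mul_of_nonneg_left h (Real.rpow_nonneg hM.le α)
  rw [h₁, h₂]
  calc (x + q) ^ α - (x + q) ^ α * (1 + -(q / (x + q))) ^ α
      ≤ (x + q) ^ α - (x + q) ^ α * (1 + α * -(q / (x + q))) := by linarith
    _ = _ := by field_simp; ring

/-- Either `n ≤ Λ / K`, or `Λ` is at most a constant multiple of `n`. -/
lemma natCast_mul_rpow_le {α Λ K : ℝ} (hα : 1 < α) (hΛ : 0 ≤ Λ) (hK : 0 < K) (n : ℕ) :
    n * (1 + Λ) ^ (α - 1) ≤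
      1 / K * (Λ * (1 + Λ) ^ (α - 1)) + (1 + K) ^ (α - 1) * (n : ℝ) ^ α := by
  have hβ : 0 ≤ α - 1 := by linarith
  rcases le_or_gt (n : ℝ) (1 / K * Λ) with h | h
  · have h₁ := mul_le_mul_of_nonneg_right h (Real.rpow_nonneg (by linarith : 0 ≤ 1 + Λ) (α - 1))
    have h₂ : 0 ≤ (1 + K) ^ (α - 1) * (n : ℝ) ^ α := by positivity
    linarith
  · have hn : 0 < n := by
      have : 0 ≤ 1 / K * Λ := by positivity
      exact_mod_cast this.trans_lt h
    have hn₁ : (1 : ℝ) ≤ n := by exact_mod_cast hn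
    have hΛn : Λ ≤ K * n := by
      rw [one_div, inv_mul_lt_iff₀ hK] at h
      exact h.le
    have h₁ : (n : ℝ) ^ α = n * (n : ℝ) ^ (α - 1) := by
      rw [Real.rpow_sub_one (by positivity)]
      field_simp
    calc n * (1 + Λ) ^ (α - 1) ≤ n * ((1 + K) * n) ^ (α - 1) := by
          gcongr
          linarith
      _ = (1 + K) ^ (α - 1) * (n : ℝ) ^ α := by
          rw [Real.mul_rpow (by positivity) (by positivity), h₁]
          ring
      _ ≤ _ := le_add_of_nonneg_left (by positivity)

namespace BayesianRouting

variable (I : BayesianRouting)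

/-- A proxy for the cost of the greedy strategy profile, in terms of expected loads. -/
noncomputable def loadPotential (α : ℝ) : ℝ :=
  ∑ e, I.speed e * (I.finalLoad α e * (1 + I.finalLoad α e) ^ (α - 1))

lemma cost_greedyStrategy_le {α : ℝ} (hα : 1 < α) :
    I.cost α (I.greedyStrategy α) ≤
      4 * (⌈α⌉₊).factorial * Real.exp 2 * I.loadPotential α := by
  unfold cost actionCost
  rw [expect_sum, loadPotential, Finset.mul_sum]
  refine Finset.sum_le_sum fun e _ => ?_
  rw [expect_const_mul]
  have h := mul_le_mul_of_nonneg_left (I.expect_greedyCount_rpow_le hα e) (I.speed_pos e).le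
  refine le_trans h (le_of_eq ?_)
  ring

lemma rpow_greedyLoad_le {α : ℝ} (hα : 1 < α) (e : Fin I.numEdges) {k : ℕ}
    (hk : k ≤ I.numAgents) :
    (1 + I.greedyLoad α k e) ^ α - 1 ≤ α * 2 ^ (α - 1) *
      ∑ i : Fin k, I.greedyUse α (Fin.castLE hk i) e * (1 + I.greedyLoad α i e) ^ (α - 1) := by
  induction k with
  | zero => simp [greedyLoad]
  | succ k ih =>
    have h₁ := ih (by omega)
    have hL := I.greedyLoad_nonneg α k e
    have hq := I.greedyUse_nonneg α ⟨k, hk⟩ e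
    have hq₁ := I.greedyUse_le_one α ⟨k, hk⟩ e
    rw [greedyLoad_succ _ _ hk, Fin.sum_univ_castSucc, mul_add]
    have h₂ := rpow_sub_rpow_le hα (by linarith : 1 ≤ 1 + I.greedyLoad α k e) hq
    have h₃ : (1 + I.greedyLoad α k e + I.greedyUse α ⟨k, hk⟩ e) ^ (α - 1) ≤
        2 ^ (α - 1) * (1 + I.greedyLoad α k e) ^ (α - 1) := by
      rw [← Real.mul_rpow zero_le_two (by linarith)]
      exact Real.rpow_le_rpow (by linarith) (by linarith) (by linarith)
    have h₄ : α * (I.greedyUse α ⟨k, hk⟩ e *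
          (1 + I.greedyLoad α k e + I.greedyUse α ⟨k, hk⟩ e) ^ (α - 1)) ≤
        α * (I.greedyUse α ⟨k, hk⟩ e * (2 ^ (α - 1) * (1 + I.greedyLoad α k e) ^ (α - 1))) := by
      gcongr
    have h₅ : α * 2 ^ (α - 1) * (I.greedyUse α ⟨k, hk⟩ e * (1 + I.greedyLoad α k e) ^ (α - 1)) =
        α * (I.greedyUse α ⟨k, hk⟩ e * (2 ^ (α - 1) * (1 + I.greedyLoad α k e) ^ (α - 1))) := by
      ring
    rw [← add_assoc]
    change _ ≤ α * 2 ^ (α - 1) * (∑ i : Fin k, I.greedyUse α (Fin.castLE (by omega) i) e *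
      (1 + I.greedyLoad α i e) ^ (α - 1)) + α * 2 ^ (α - 1) *
      (I.greedyUse α ⟨k, hk⟩ e * (1 + I.greedyLoad α k e) ^ (α - 1))
    linarith

/-- The potential is bounded by the total weight of the chosen paths, each taken at the time of its
choice: the marginal costs add up to the convex function `(1 + Λ) ^ α - 1`. -/
lemma loadPotential_le {α : ℝ} (hα : 1 < α) :
    I.loadPotential α ≤ α * 2 ^ (α - 1) * 2 ^ α *
      ∑ i, ∑ e, I.greedyUse α i e * I.greedyWeight α i e := by
  rw [Finset.sum_comm, loadPotential, Finset.mul_sum]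
  refine Finset.sum_le_sum fun e _ => ?_
  have hξ := I.speed_pos e
  have hΛ := I.finalLoad_nonneg α e
  have h₁ : I.finalLoad α e * (1 + I.finalLoad α e) ^ (α - 1) ≤ (1 + I.finalLoad α e) ^ α - 1 := by
    have h : (1 + I.finalLoad α e) ^ α =
        (1 + I.finalLoad α e) * (1 + I.finalLoad α e) ^ (α - 1) := by
      rw [Real.rpow_sub_one (by positivity)]
      field_simp
    have := Real.one_le_rpow (by linarith : 1 ≤ 1 + I.finalLoad α e) (by linarith : 0 ≤ α - 1)
    linarith
  calc I.speed e * (I.finalLoad α e * (1 + I.finalLoad α e) ^ (α - 1))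
      ≤ I.speed e * (α * 2 ^ (α - 1) *
          ∑ i, I.greedyUse α i e * (1 + I.greedyLoad α i e) ^ (α - 1)) := by
        refine mul_le_mul_of_nonneg_left ?_ hξ.le
        exact h₁.trans (I.rpow_greedyLoad_le hα e le_rfl)
    _ = α * 2 ^ (α - 1) *
          ∑ i : Fin I.numAgents, I.greedyUse α i e *
            (I.speed e * (1 + I.greedyLoad α i e) ^ (α - 1)) := by
        simp only [Finset.mul_sum]
        exact Finset.sum_congr rfl fun i _ => by ring
    _ ≤ α * 2 ^ (α - 1) *
          ∑ i : Fin I.numAgents, I.greedyUse α i e * (2 ^ α * I.greedyWeight α i e) := by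
        refine mul_le_mul_of_nonneg_left (Finset.sum_le_sum fun i _ => ?_) (by positivity)
        exact mul_le_mul_of_nonneg_left (le_roundedWeight hα hξ (I.greedyLoad_nonneg α i e))
          (I.greedyUse_nonneg α i e)
    _ = _ := by
        simp only [Finset.mul_sum]
        exact Finset.sum_congr rfl fun i _ => by ring

/-- For every type profile, the greedy paths are compared with an arbitrary action profile. The
parameter `K` balances the share of the potential against the factor of the cost. -/
lemma sum_greedyWeight_le {α K : ℝ} (hα : 1 < α) (hK : 0 < K) {t : I.TypeProfile}
    (a : I.ActionProfile t) :
    ∑ i, ∑ e ∈ I.greedyPath α i (t i), I.greedyWeight α i e ≤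
      2 ^ (α - 1) * (1 / K * I.loadPotential α + (1 + K) ^ (α - 1) * I.actionCost α a) := by
  have hW : ∀ (i : Fin I.numAgents) e, I.greedyWeight α i e ≤
      2 ^ (α - 1) * (I.speed e * (1 + I.finalLoad α e) ^ (α - 1)) := by
    intro i e
    have hL := I.greedyLoad_nonneg α i e
    have hξ := I.speed_pos e
    refine (roundedWeight_le hα hξ hL).trans ?_
    have : I.greedyLoad α i e ≤ I.finalLoad α e := I.greedyLoad_mono α e i.2.le
    have : 0 ≤ α - 1 := by linarith
    gcongr
  calc ∑ i, ∑ e ∈ I.greedyPath α i (t i), I.greedyWeight α i e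
      ≤ ∑ i, ∑ e ∈ (a i).1, I.greedyWeight α i e := Finset.sum_le_sum fun i _ =>
        (Network.shortestPath_spec (I.greedyWeight_pos α i) (a i).2).2
    _ ≤ ∑ i, ∑ e ∈ (a i).1, 2 ^ (α - 1) * (I.speed e * (1 + I.finalLoad α e) ^ (α - 1)) :=
        Finset.sum_le_sum fun i _ => Finset.sum_le_sum fun e _ => hW i e
    _ = ∑ e, 2 ^ (α - 1) * (I.speed e * (I.load a e * (1 + I.finalLoad α e) ^ (α - 1))) := by
        have h : ∀ i : Fin I.numAgents,
            ∑ e ∈ (a i).1, 2 ^ (α - 1) * (I.speed e * (1 + I.finalLoad α e) ^ (α - 1)) =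
            ∑ e, if e ∈ (a i).1 then 2 ^ (α - 1) * (I.speed e *
              (1 + I.finalLoad α e) ^ (α - 1)) else 0 := fun i => by
          rw [Finset.sum_ite_mem, Finset.univ_inter]
        simp only [h]
        rw [Finset.sum_comm]
        refine Finset.sum_congr rfl fun e _ => ?_
        rw [← Finset.sum_filter, Finset.sum_const, nsmul_eq_mul, load]
        ring
    _ ≤ ∑ e, 2 ^ (α - 1) * (I.speed e * (1 / K * (I.finalLoad α e *
          (1 + I.finalLoad α e) ^ (α - 1)) + (1 + K) ^ (α - 1) * (I.load a e : ℝ) ^ α)) := by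
        gcongr with e
        · exact (I.speed_pos e).le
        · exact natCast_mul_rpow_le hα (I.finalLoad_nonneg α e) hK _
    _ = _ := by
        rw [loadPotential, actionCost]
        simp only [Finset.mul_sum, ← Finset.sum_add_distrib]
        exact Finset.sum_congr rfl fun e _ => by ring

lemma exists_actionCost_eq_opt (α : ℝ) (t : I.TypeProfile) :
    ∃ a : I.ActionProfile t, I.actionCost α a = I.opt α t := by
  have : ∀ i, Finite (I.Action i (t i)) := fun i => by unfold Action; infer_instance
  have : Nonempty (I.ActionProfile t) := ⟨fun i => I.greedyStrategy α i (t i)⟩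
  exact exists_eq_ciInf_of_finite

lemma sum_greedyUse_mul_greedyWeight_le {α K : ℝ} (hα : 1 < α) (hK : 0 < K) :
    ∑ i, ∑ e, I.greedyUse α i e * I.greedyWeight α i e ≤ 2 ^ (α - 1) *
      (1 / K * I.loadPotential α + (1 + K) ^ (α - 1) * I.expect (I.opt α)) := by
  have h₁ : ∑ i, ∑ e, I.greedyUse α i e * I.greedyWeight α i e =
      I.expect fun t => ∑ i, ∑ e ∈ I.greedyPath α i (t i), I.greedyWeight α i e := by
    rw [expect_sum]
    refine Finset.sum_congr rfl fun i _ => ?_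
    rw [I.expect_marginal i fun x => ∑ e ∈ I.greedyPath α i x, I.greedyWeight α i e]
    simp only [greedyUse, Finset.sum_mul]
    rw [Finset.sum_comm]
    refine Finset.sum_congr rfl fun x _ => ?_
    simp only [ite_mul, zero_mul]
    rw [Finset.sum_ite_mem, Finset.univ_inter, Finset.mul_sum]
  rw [h₁]
  refine (I.expect_mono (g := fun t => 2 ^ (α - 1) * (1 / K * I.loadPotential α +
    (1 + K) ^ (α - 1) * I.opt α t)) fun t => ?_).trans_eq ?_
  · obtain ⟨a, ha⟩ := I.exists_actionCost_eq_opt α t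
    rw [← ha]
    exact I.sum_greedyWeight_le hα hK a
  · rw [expect_const_mul, expect_add, expect_const, expect_const_mul]

/-- The constant by which the greedy strategy profile is competitive. -/
noncomputable def ratioBound (α : ℝ) : ℝ :=
  4 * (⌈α⌉₊).factorial * Real.exp 2 *
    (2 * (α * 2 ^ (α - 1) * 2 ^ α * 2 ^ (α - 1)) *
      (1 + 2 * (α * 2 ^ (α - 1) * 2 ^ α * 2 ^ (α - 1))) ^ (α - 1))

lemma cost_greedyStrategy_le_opt {α : ℝ} (hα : 1 < α) :
    I.cost α (I.greedyStrategy α) ≤ ratioBound α * I.expect (I.opt α) := by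
  have hα₀ : 0 < α := by linarith
  set D := α * 2 ^ (α - 1) * 2 ^ α * 2 ^ (α - 1) with hD
  have hD₀ : 0 < D := by positivity
  have h : I.loadPotential α ≤ 2 * D * (1 + 2 * D) ^ (α - 1) * I.expect (I.opt α) := by
    have h₁ := I.loadPotential_le hα
    -- With `K = 2 * D`, half of the potential is absorbed on the left.
    have h₂ := mul_le_mul_of_nonneg_left
      (I.sum_greedyUse_mul_greedyWeight_le hα (by positivity : 0 < 2 * D))
      (by positivity : 0 ≤ α * 2 ^ (α - 1) * 2 ^ α)
    have h₃ : α * 2 ^ (α - 1) * 2 ^ α * (2 ^ (α - 1) * (1 / (2 * D) * I.loadPotential α +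
        (1 + 2 * D) ^ (α - 1) * I.expect (I.opt α))) =
        I.loadPotential α / 2 + D * (1 + 2 * D) ^ (α - 1) * I.expect (I.opt α) := by
      calc _ = D * (1 / (2 * D)) * I.loadPotential α +
            D * (1 + 2 * D) ^ (α - 1) * I.expect (I.opt α) := by rw [hD]; ring
        _ = _ := by
          congr 1
          field_simp
    linarith
  refine (I.cost_greedyStrategy_le hα).trans ?_
  rw [ratioBound, ← hD, mul_assoc _ (2 * D * (1 + 2 * D) ^ (α - 1))]
  exact mul_le_mul_of_nonneg_left h (by positivity)

end BayesianRouting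

/-- The factors that work for all instances form a closed set, so there is a least one. -/
lemma exists_isBCR {α : ℝ} {A : (I : BayesianRouting) → I.StrategyProfile} {b : ℝ}
    (h : ∀ I : BayesianRouting, I.cost α (A I) ≤ b * I.expect (I.opt α))
    (hO : ∀ I : BayesianRouting, 0 ≤ I.expect (I.opt α)) : ∃ β, IsBCR α A β := by
  have hcl : IsClosed {b : ℝ | 1 ≤ b ∧
      ∀ I : BayesianRouting, I.cost α (A I) ≤ b * I.expect (I.opt α)} := by
    simp only [Set.ofPred_and, Set.ofPred_forall]
    exact isClosed_Ici.inter (isClosed_iInter fun I => isClosed_le (by fun_prop) (by fun_prop))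
  refine ⟨_, hcl.isLeast_csInf ⟨max 1 b, le_max_left _ _, fun I => (h I).trans ?_⟩
    ⟨1, fun b hb => hb.1⟩⟩
  exact mul_le_mul_of_nonneg_right (le_max_right _ _) (hO I)

lemma BayesianRouting.expect_opt_nonneg (I : BayesianRouting) (α : ℝ) :
    0 ≤ I.expect (I.opt α) := by
  rw [← I.expect_const 0]
  refine I.expect_mono fun t => Real.iInf_nonneg fun a => Finset.sum_nonneg fun e _ => ?_
  have := I.speed_pos e
  positivity

/-- Some fully combinatorial algorithm for Bayesian routing runs in strongly polynomial time and has
a (finite) Bayesian competitive ratio that depends only on the load exponent. -/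
theorem theorem1 :
    ∃ (P : Combinatorial.Program) (A : ℝ → (I : BayesianRouting) → I.StrategyProfile),
      Combinatorial.ComputesInStronglyPolyTime P A ∧
      ∃ β : ℝ → ℝ, ∀ α : ℝ, 1 < α → IsBCR α (A α) (β α) := by
  have h : ∀ α : ℝ, ∃ β, 1 < α → IsBCR α (fun I => I.greedyStrategy α) β := by
    intro α
    by_cases hα : 1 < α
    · obtain ⟨β, hβ⟩ := exists_isBCR (fun I => I.cost_greedyStrategy_le_opt hα)
        fun I => I.expect_opt_nonneg α
      exact ⟨β, fun _ => hβ⟩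
    · exact ⟨0, fun h => absurd h hα⟩
  choose β hβ using h
  exact ⟨Combinatorial.greedyProgram, fun α I => I.greedyStrategy α,
    Combinatorial.computes_greedyStrategy, β, hβ⟩
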